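/- **Setting (the Pentagon system near a bad fibre).** Let $\Gamma=\mathbb Z\gamma_e\oplus\mathbb Z\gamma_m$ with the skew-symmetric pairing determined by $\langle\gamma_m,\gamma_e\rangle=1$. A point of the base, off the wall of marginal stability, is described by central charges $Z_{\gamma_e}=a\in\mathbb C$, $Z_{\gamma_m}\in\mathbb C$ with $a\,\overline{Z_{\gamma_m}}\notin\mathbb R$, extended to $\Gamma$ by linearity, and by the set $J\subset\Gamma$ of charges with $\Omega(\gamma)\neq 0$ (then $\Omega(\gamma)=1$), which is one of $$J_{\rm in}=\{\pm\gamma_e,\pm\gamma_m\},\qquad J_{\rm out,I}=J_{\rm in}\cup\{\pm(\gamma_e+\gamma_m)\},\qquad J_{\rm out,II}=J_{\rm in}\cup\{\pm(-\gamma_e+\gamma_m)\}.$$ For $R>0$, $\theta=(\theta_e,\theta_m)\in\mathbb R^2$ and $\gamma=p\gamma_e+q\gamma_m$ put $\theta_\gamma=p\theta_e+q\theta_m+\pi pq$, $$\mathcal X^{\rm sf}_\gamma(\zeta)=\exp\Big(\frac{\pi R Z_\gamma}{\zeta}+i\theta_\gamma+\pi R\,\zeta\,\overline{Z_\gamma}\Big),\qquad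 \ell_\gamma=Z_\gamma\mathbb R_-=\{-s\,Z_\gamma/|Z_\gamma| : s>0\}.$$ A *solution* at $\theta$ is a family of functions $(\mathcal X_\gamma)_{\gamma\in\Gamma}$ such that 1. for $\gamma\in J$, $|\mathcal X_\gamma|\le 2|\mathcal X_\gamma^{\rm sf}|$ on $\ell_\gamma$, and $\int_{\ell_\gamma}\frac{d\zeta'}{\zeta'}\log(1-\mathcal X_\gamma(\zeta'))$ converges absolutely; 2. for all $\gamma\in\Gamma$ and all $\zeta\in\mathbb C^\times$ off the rays $\ell_{\gamma'}$ with $\gamma'\in J$, $\langle\gamma,\gamma'\rangle\ne0$, $$\mathcal X_\gamma(\zeta)=\mathcal X^{\rm sf}_\gamma(\zeta)\exp\Big[-\frac1{4\pi i}\sum_{\gamma'\in J}\langle\gamma,\gamma'\rangle\int_{\ell_{\gamma'}}\frac{d\zeta'}{\zeta'}\,\frac{\zeta'+\zeta}{\zeta'-\zeta}\,\log\big(1-\mathcal X_{\gamma'}(\zeta')\big)\Big],$$ the rays being oriented from $0$ to $\infty$. The gauge function of a solution is $$\psi(a,\theta)=\frac1{2\pi}\int_0^1\frac{dt}{t}\sum_{\gamma\in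 G}\log\left|\frac{1-\mathcal X_\gamma(-te^{i\arg Z_\gamma})}{1-\mathcal X_{-\gamma}(te^{i\arg Z_\gamma})}\right|,$$ where $G=\{\gamma_e\}$ for $J=J_{\rm in}$, $G=\{\gamma_e,\gamma_e+\gamma_m\}$ for $J=J_{\rm out,I}$ and $G=\{\gamma_e,-\gamma_e+\gamma_m\}$ for $J=J_{\rm out,II}$. **Theorem.** Fix one of the three sets $J$, and let $K$ be a compact set of pairs $(a,Z_{\gamma_m})\in\mathbb C^2$ with $a\,\overline{Z_{\gamma_m}}\notin\mathbb R$ (for instance a single pair). There is $R_0>0$ such that for all $R\ge R_0$, all $(a,Z_{\gamma_m})\in K$ and all $\theta_e\in\mathbb R$ the following holds. For every $\theta_m\in\mathbb R$ a solution at $(\theta_e,\theta_m)$ exists; and for any choice of a solution for each $\theta_m$, the integral defining $\psi(a,\theta_e,\theta_m)$ converges absolutely for every $\theta_m$, and $$Q(\theta_m)=\theta_m+\psi(a,\theta_e,\theta_m)$$ is a $C^\infty$ function on $\mathbb R$ with $Q(\theta_m+2\pi)=Q(\theta_m)+2\pi$ which induces a $C^\infty$ diffeomorphism of $\mathbb R/2\pi\mathbb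 Z$. -/

import Mathlib

open MeasureTheory Set
open scoped Manifold ContDiff

noncomputable section

namespace Pentagon

/-- The charge lattice `Γ`: the pair `(p, q)` is the charge `p γ_e + q γ_m`. -/
abbrev Charge : Type := ℤ × ℤ

/-- The skew-symmetric pairing on `Γ` normalised by `⟨γ_m, γ_e⟩ = 1`. -/
def pairing (γ γ' : Charge) : ℤ := γ.2 * γ'.1 - γ.1 * γ'.2

/-- The three possible local descriptions of the Pentagon spectrum near the bad fibre `a = 0`:
the inside of the wall of marginal stability, and its outside, labelled either by the basis
adapted to a wall-crossing of type I or by the basis adapted to a wall-crossing of type II. -/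
inductive Chamber where
  | inside
  | outsideI
  | outsideII

/-- The charges `γ` with `Ω(γ) ≠ 0`; for each of them `Ω(γ) = 1`. -/
def bpsCharges : Chamber → Finset Charge
  | .inside => {(1, 0), (-1, 0), (0, 1), (0, -1)}
  | .outsideI => {(1, 0), (-1, 0), (0, 1), (0, -1), (1, 1), (-1, -1)}
  | .outsideII => {(1, 0), (-1, 0), (0, 1), (0, -1), (-1, 1), (1, -1)}

/-- The charges whose BPS rays contribute to the gauge function `ψ`:
`γ_e`; `γ_e, γ_e + γ_m`; `γ_e, -γ_e + γ_m`. -/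
def gaugeCharges : Chamber → Finset Charge
  | .inside => {(1, 0)}
  | .outsideI => {(1, 0), (1, 1)}
  | .outsideII => {(1, 0), (-1, 1)}

/-- The central charge, with `Z_{γ_e} = Z.1 = a` and `Z_{γ_m} = Z.2`. -/
def centralCharge (Z : ℂ × ℂ) (γ : Charge) : ℂ := γ.1 * Z.1 + γ.2 * Z.2

/-- The torus coordinate `θ_γ`. The summand `π p q` makes the semiflat functions twisted characters:
`X_γ X_γ' = (-1)^⟨γ, γ'⟩ X_{γ + γ'}`. -/
def theta (θe θm : ℝ) (γ : Charge) : ℝ := γ.1 * θe + γ.2 * θm + Real.pi * (γ.1 * γ.2)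

/-- The semiflat functions `exp (π R Z_γ / ζ + i θ_γ + π R ζ conj Z_γ)`. -/
def Xsf (R : ℝ) (Z : ℂ × ℂ) (θe θm : ℝ) (γ : Charge) (ζ : ℂ) : ℂ :=
  Complex.exp (Real.pi * R * centralCharge Z γ / ζ + Complex.I * theta θe θm γ
    + Real.pi * R * ζ * (starRingEnd ℂ) (centralCharge Z γ))

/-- The point `-s e^{i arg z}`, at distance `s` from `0` on the ray `z ℝ_-`. -/
def rayPoint (z : ℂ) (s : ℝ) : ℂ := -(s * (z / ‖z‖))

/-- The BPS ray `ℓ_γ = Z_γ ℝ_-`. -/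
def bpsRay (Z : ℂ × ℂ) (γ : Charge) : Set ℂ :=
  {ζ | ∃ s : ℝ, 0 < s ∧ ζ = rayPoint (centralCharge Z γ) s}

/-- `∫_{ℓ_γ} (dζ'/ζ') (ζ' + ζ)/(ζ' - ζ) log (1 - X_γ(ζ'))`, the ray being oriented from `0` to `∞`
and parametrised by `ζ' = -s e^{i arg Z_γ}`. -/
def rayIntegral (Z : ℂ × ℂ) (X : Charge → ℂ → ℂ) (γ : Charge) (ζ : ℂ) : ℂ :=
  ∫ s in Ioi (0 : ℝ),
    (s : ℂ)⁻¹ * ((rayPoint (centralCharge Z γ) s + ζ) / (rayPoint (centralCharge Z γ) s - ζ))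
      * Complex.log (1 - X γ (rayPoint (centralCharge Z γ) s))

/-- The family `X_γ(ζ)`, `γ ∈ Γ`, solves the integral equation of the Riemann-Hilbert problem with
jumps at the BPS rays. `X_γ` jumps exactly at the BPS rays `ℓ_γ'` with `⟨γ, γ'⟩ ≠ 0`, so it is
prescribed off these rays. The solution is the one close to the semiflat functions. -/
structure IsSolution (c : Chamber) (R : ℝ) (Z : ℂ × ℂ) (θe θm : ℝ) (X : Charge → ℂ → ℂ) :
    Prop where
  /-- On its own BPS ray `X_γ` differs from the semiflat function by a factor at most `2`. -/
  bound : ∀ γ ∈ bpsCharges c, ∀ ζ ∈ bpsRay Z γ, ‖X γ ζ‖ ≤ 2 * ‖Xsf R Z θe θm γ ζ‖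
  /-- The integrals in the integral equation converge absolutely. -/
  integrable : ∀ γ ∈ bpsCharges c, IntegrableOn
    (fun s : ℝ => (s : ℂ)⁻¹ * Complex.log (1 - X γ (rayPoint (centralCharge Z γ) s))) (Ioi 0)
  /-- The integral equation. -/
  equation : ∀ (γ : Charge) (ζ : ℂ), ζ ≠ 0 →
    (∀ γ' ∈ bpsCharges c, pairing γ γ' ≠ 0 → ζ ∉ bpsRay Z γ') →
    X γ ζ = Xsf R Z θe θm γ ζ * Complex.exp (-(1 / (4 * Real.pi * Complex.I)) *
      ∑ γ' ∈ bpsCharges c, (pairing γ γ' : ℂ) * rayIntegral Z X γ' ζ)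

/-- The integrand of the gauge function: the sum over the charges `γ` above of
`(1/t) log |(1 - X_γ(-t e^{i arg Z_γ})) / (1 - X_{-γ}(t e^{i arg Z_γ}))|`. -/
def gaugeIntegrand (c : Chamber) (Z : ℂ × ℂ) (X : Charge → ℂ → ℂ) (t : ℝ) : ℝ :=
  t⁻¹ * ∑ γ ∈ gaugeCharges c,
    Real.log ‖(1 - X γ (rayPoint (centralCharge Z γ) t)) /
      (1 - X (-γ) (-rayPoint (centralCharge Z γ) t))‖

/-- The gauge function `ψ`. -/
def psi (c : Chamber) (Z : ℂ × ℂ) (X : Charge → ℂ → ℂ) : ℝ :=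
  1 / (2 * Real.pi) * ∫ t in Ioo (0 : ℝ) 1, gaugeIntegrand c Z X t

/-- `Q : ℝ → ℝ` descends to a smooth diffeomorphism of `ℝ / 2πℤ`, the latter being identified with
the unit circle through `θ ↦ e^{iθ}`. -/
structure InducesCircleDiffeo (Q : ℝ → ℝ) : Prop where
  contDiff : ContDiff ℝ ∞ Q
  add_two_pi : ∀ θ : ℝ, Q (θ + 2 * Real.pi) = Q θ + 2 * Real.pi
  diffeo : ∃ Φ : Diffeomorph (𝓡 1) (𝓡 1) Circle Circle ∞,
    ∀ θ : ℝ, Φ (Circle.exp θ) = Circle.exp (Q θ)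

end Pentagon

end

/-! The values of each `X_γ` on its own ray determine the whole family, and there the semiflat
function has modulus exp(-πR|Z_γ|(s + 1/s)). Since Im(Z_γ conj Z_γ') is -⟨γ,γ'⟩ times Im(a conj
Z_γm), rays that interact are uniformly transversal over the compact set, so the kernel is bounded
by C/y. For large R the map on exponents is then a 1/2-contraction in the supremum norm: the ray
problem has exactly one solution, and the integral formula extends it off the rays.

Smoothness and monotonicity in θ_m both come from making θ_m a complex number τ. In the strip |Im τ|
< 1 the phases stay bounded by 3, so the contraction survives; the Picard iterates are holomorphic
in τ and converge uniformly. By uniqueness every choice of solutions agrees with this holomorphic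
family on the rays, so ψ is the real part of a holomorphic H with |H| ≤ 1/4. Cauchy's estimate on
discs of radius 1/2 gives |H'| ≤ 1/2 on the real axis, whence Q' ≥ 1/2. Periodicity of ψ is
uniqueness again, as the phases are 2π-periodic. A smooth Q with Q' > 0 commuting with the shift by
2π descends to a diffeomorphism of the circle.

The main steps are `IsContractive.unique`, `IsContractive.exists_holomorphic_solution`,
`exists_rayBounds`, `exists_holomorphic_psi` and `inducesCircleDiffeo_of_deriv_pos`. -/

namespace Pentagon

open Filter Topology

/-! ### Holomorphic dependence of integrals on a parameter -/

section Holomorphic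

open Metric

variable {Ω : Type*} [MeasurableSpace Ω] {ν : Measure Ω}

/-- An integral of holomorphic functions, dominated by an integrable function, is holomorphic in
the parameter. -/
theorem differentiableOn_integral_of_dominated {F : ℂ → Ω → ℂ} {b : Ω → ℝ} {U : Set ℂ}
    (hU : IsOpen U) (hmeas : ∀ τ ∈ U, AEStronglyMeasurable (F τ) ν)
    (hb : ∀ τ ∈ U, ∀ y, ‖F τ y‖ ≤ b y) (hbi : Integrable b ν)
    (hd : ∀ y, DifferentiableOn ℂ (fun τ => F τ y) U) :
    DifferentiableOn ℂ (fun τ => ∫ y, F τ y ∂ν) U := by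
  intro τ₀ hτ₀
  obtain ⟨ε, hε, hεU⟩ := Metric.isOpen_iff.1 hU τ₀ hτ₀
  -- With a third of the radius, closed `r`-discs about points of the `r`-disc around `τ₀` stay in
  -- `U`; Cauchy's estimate there bounds the derivative by `b y / r`, so no bound on derivatives
  -- need be assumed.
  set r : ℝ := ε / 3 with hr
  have hr0 : 0 < r := by positivity
  have hball : ∀ τ ∈ ball τ₀ r, closedBall τ r ⊆ U := by
    intro τ hτ x hx
    apply hεU
    rw [mem_ball] at hτ ⊢
    rw [mem_closedBall] at hx
    linarith [dist_triangle x τ τ₀]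
  have hmem : ∀ τ ∈ ball τ₀ r, τ ∈ U := fun τ hτ => hball τ hτ (mem_closedBall_self hr0.le)
  have hder : ∀ y, ∀ τ ∈ U, HasDerivAt (fun τ => F τ y) (deriv (fun τ => F τ y) τ) τ :=
    fun y τ hτ => ((hd y).differentiableAt (hU.mem_nhds hτ)).hasDerivAt
  refine (hasDerivAt_integral_of_dominated_loc_of_deriv_le (bound := fun y => b y / r)
    (F' := fun τ y => deriv (fun τ => F τ y) τ) (ball_mem_nhds τ₀ hr0) ?_ ?_ ?_ ?_
    (hbi.div_const r) ?_).2.differentiableAt.differentiableWithinAt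
  · filter_upwards [hU.mem_nhds hτ₀] with τ hτ using hmeas τ hτ
  · exact hbi.mono' (hmeas τ₀ hτ₀) (Eventually.of_forall (hb τ₀ hτ₀))
  -- The derivative is measurable in `y` as a pointwise limit of difference quotients; the steps, at
  -- most `r / 2`, keep the sample points in the disc.
  · let h : ℕ → ℂ := fun n => ((r / 2 * (1 / ((n : ℝ) + 1)) : ℝ) : ℂ)
    have hpos : ∀ n : ℕ, 0 < r / 2 * (1 / ((n : ℝ) + 1)) := fun n => by positivity
    have hlim : Tendsto h atTop (𝓝[≠] 0) := by
      refine tendsto_nhdsWithin_iff.2 ⟨?_, Eventually.of_forall fun n => ?_⟩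
      · have := (tendsto_one_div_add_atTop_nhds_zero_nat (𝕜 := ℝ)).const_mul (r / 2)
        rw [mul_zero] at this
        have hc := (Complex.continuous_ofReal.tendsto 0).comp this
        rwa [Complex.ofReal_zero] at hc
      · exact Complex.ofReal_ne_zero.2 (hpos n).ne'
    refine aestronglyMeasurable_of_tendsto_ae (f := fun n y => (h n)⁻¹ • (F (τ₀ + h n) y - F τ₀ y))
      atTop (fun n => AEStronglyMeasurable.fun_const_smul
        (f := fun y => F (τ₀ + h n) y - F τ₀ y) ((hmeas _ (hmem _ ?_)).sub (hmeas τ₀ hτ₀)) _)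
      (Eventually.of_forall fun y => (hder y τ₀ hτ₀).tendsto_slope_zero.comp hlim)
    rw [mem_ball, dist_eq_norm, add_sub_cancel_left, Complex.norm_real, Real.norm_eq_abs,
      abs_of_pos (hpos n)]
    have : 1 / ((n : ℝ) + 1) ≤ 1 := by
      rw [div_le_one (by positivity)]
      linarith [n.cast_nonneg (α := ℝ)]
    nlinarith
  · refine Eventually.of_forall fun y τ hτ => ?_
    exact Complex.norm_deriv_le_of_forall_mem_sphere_norm_le hr0
      ((hd y).diffContOnCl_ball (hball τ hτ))
      fun z hz => hb z (hball τ hτ (sphere_subset_closedBall hz)) y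
  · exact Eventually.of_forall fun y τ hτ => hder y τ (hmem τ hτ)

end Holomorphic

/-! ### Lipschitz bounds for log(1 - z) and exp -/

section Log

open Metric

theorem one_sub_mem_slitPlane {z : ℂ} (hz : ‖z‖ ≤ 1 / 2) : 1 - z ∈ Complex.slitPlane := by
  rw [sub_eq_add_neg]
  exact Complex.mem_slitPlane_of_norm_lt_one (by rw [norm_neg]; linarith)

theorem norm_log_one_sub_sub_le {z z' : ℂ} (hz : ‖z‖ ≤ 1 / 2) (hz' : ‖z'‖ ≤ 1 / 2) :
    ‖Complex.log (1 - z) - Complex.log (1 - z')‖ ≤ 2 * ‖z - z'‖ := by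
  refine (convex_closedBall (0 : ℂ) (1 / 2)).norm_image_sub_le_of_norm_hasDerivWithin_le
    (f := fun z => Complex.log (1 - z)) (f' := fun z => -1 / (1 - z)) (fun x hx => ?_)
    (fun x hx => ?_) (by simpa using hz') (by simpa using hz)
  · rw [mem_closedBall_zero_iff] at hx
    exact (((hasDerivAt_id x).const_sub 1).clog (one_sub_mem_slitPlane hx)).hasDerivWithinAt
  · rw [mem_closedBall_zero_iff] at hx
    have h : 1 / 2 ≤ ‖1 - x‖ := by
      have := norm_sub_norm_le (1 : ℂ) x
      rw [norm_one] at this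
      linarith
    rw [norm_div, norm_neg, norm_one, div_le_iff₀ (by linarith)]
    linarith

theorem norm_log_one_sub_le {z : ℂ} (hz : ‖z‖ ≤ 1 / 2) : ‖Complex.log (1 - z)‖ ≤ 2 * ‖z‖ := by
  simpa using norm_log_one_sub_sub_le hz (z' := 0) (by simp)

theorem exp_one_le_three : Real.exp 1 ≤ 3 := by linarith [Real.exp_one_lt_d9]

theorem norm_exp_le_three {z : ℂ} (hz : ‖z‖ ≤ 1) : ‖Complex.exp z‖ ≤ 3 :=
  (Complex.norm_exp_le_exp_norm z).trans ((Real.exp_le_exp.2 hz).trans exp_one_le_three)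

theorem norm_exp_sub_exp_le {z z' : ℂ} (hz : ‖z‖ ≤ 1) (hz' : ‖z'‖ ≤ 1) :
    ‖Complex.exp z - Complex.exp z'‖ ≤ 3 * ‖z - z'‖ := by
  refine (convex_closedBall (0 : ℂ) 1).norm_image_sub_le_of_norm_hasDerivWithin_le
    (f := Complex.exp) (f' := Complex.exp) (fun x _ => (Complex.hasDerivAt_exp x).hasDerivWithinAt)
    (fun x hx => norm_exp_le_three (by simpa using hx)) (by simpa using hz') (by simpa using hz)

end Log

/-! ### The contraction argument for an abstract integral equation -/

section FixedPoint

variable {ι Ω : Type*} [Fintype ι] [MeasurableSpace Ω] {ν : Measure Ω}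
  {K : ι → Ω → ι → Ω → ℂ} {κ : Ω → ℝ} {w : ι → Ω → ℝ}

/-- The kernel `K` and the weights `w` are so small that
`g ↦ ∑ j, ∫ K i s j y log (1 - e j * w j y * exp (g j y)) dν(y)` contracts distances by `1 / 2` on
the unit ball for the supremum norm, whenever `‖e j‖ ≤ 3`. -/
structure IsContractive (ν : Measure Ω) (K : ι → Ω → ι → Ω → ℂ) (κ : Ω → ℝ) (w : ι → Ω → ℝ) :
    Prop where
  measurable_kernel : ∀ i j, Measurable fun p : Ω × Ω => K i p.1 j p.2
  kernel_le : ∀ i s j y, ‖K i s j y‖ ≤ κ y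
  measurable_weight : ∀ j, Measurable (w j)
  weight_nonneg : ∀ j y, 0 ≤ w j y
  -- Dressed functions are at most `9 * w`, a 3 for the coefficient and a 3 for exp on the unit
  -- disc; 9/20 < 1/2 keeps them where log(1 - z) is 2-Lipschitz.
  weight_le : ∀ j y, w j y ≤ 1 / 20
  integrable : ∀ j, Integrable (fun y => κ y * w j y) ν
  -- The Lipschitz constant 2 of the logarithm and the factor 9 give 18 · 1/36 = 1/2, the
  -- contraction ratio.
  sum_le : ∑ j, ∫ y, κ y * w j y ∂ν ≤ 1 / 36

/-- The exponent `∑ j, ∫ K i s j y log (1 - f j y) dν(y)` of the integral equation. -/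
noncomputable def exponent (ν : Measure Ω) (K : ι → Ω → ι → Ω → ℂ) (f : ι → Ω → ℂ) (i : ι)
    (s : Ω) : ℂ :=
  ∑ j, ∫ y, K i s j y * Complex.log (1 - f j y) ∂ν

/-- The function `e i * w i s * exp (g i s)` with exponent `g`. -/
noncomputable def dressed (e : ι → ℂ) (w : ι → Ω → ℝ) (g : ι → Ω → ℂ) (i : ι) (s : Ω) : ℂ :=
  e i * w i s * Complex.exp (g i s)

namespace IsContractive

variable (h : IsContractive ν K κ w)
include h

theorem norm_dressed_le {e : ι → ℂ} (he : ∀ i, ‖e i‖ ≤ 3) {g : ι → Ω → ℂ}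
    (hg : ∀ i s, ‖g i s‖ ≤ 1) (i : ι) (s : Ω) : ‖dressed e w g i s‖ ≤ 9 * w i s := by
  have hw := h.weight_nonneg i s
  rw [dressed, norm_mul, norm_mul, Complex.norm_real, Real.norm_of_nonneg hw]
  calc ‖e i‖ * w i s * ‖Complex.exp (g i s)‖ ≤ 3 * w i s * 3 := by
        gcongr
        · exact he i
        · exact norm_exp_le_three (hg i s)
    _ = 9 * w i s := by ring

theorem norm_dressed_sub_le {e : ι → ℂ} (he : ∀ i, ‖e i‖ ≤ 3) {g g' : ι → Ω → ℂ}
    (hg : ∀ i s, ‖g i s‖ ≤ 1) (hg' : ∀ i s, ‖g' i s‖ ≤ 1) {D : ℝ}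
    (hD : ∀ i s, ‖g i s - g' i s‖ ≤ D) (i : ι) (s : Ω) :
    ‖dressed e w g i s - dressed e w g' i s‖ ≤ D * (9 * w i s) := by
  have hw := h.weight_nonneg i s
  rw [dressed, dressed, ← mul_sub, norm_mul, norm_mul, Complex.norm_real, Real.norm_of_nonneg hw]
  calc ‖e i‖ * w i s * ‖Complex.exp (g i s) - Complex.exp (g' i s)‖ ≤ 3 * w i s * (3 * D) := by
        gcongr
        · exact he i
        · exact (norm_exp_sub_exp_le (hg i s) (hg' i s)).trans
            (mul_le_mul_of_nonneg_left (hD i s) (by norm_num))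
    _ = D * (9 * w i s) := by ring

theorem norm_le_half {f : ι → Ω → ℂ} (hf : ∀ i s, ‖f i s‖ ≤ 9 * w i s) (i : ι) (s : Ω) :
    ‖f i s‖ ≤ 1 / 2 := by
  linarith [hf i s, h.weight_le i s]

theorem norm_kernel_mul_log_le {f : ι → Ω → ℂ} (hf : ∀ i s, ‖f i s‖ ≤ 9 * w i s) (i : ι) (s : Ω)
    (j : ι) (y : Ω) : ‖K i s j y * Complex.log (1 - f j y)‖ ≤ 18 * (κ y * w j y) := by
  rw [norm_mul]
  calc ‖K i s j y‖ * ‖Complex.log (1 - f j y)‖ ≤ κ y * (2 * (9 * w j y)) := by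
        gcongr
        · exact (norm_nonneg _).trans (h.kernel_le i s j y)
        · exact h.kernel_le i s j y
        · exact (norm_log_one_sub_le (h.norm_le_half hf j y)).trans
            (mul_le_mul_of_nonneg_left (hf j y) (by norm_num))
    _ = 18 * (κ y * w j y) := by ring

theorem integrable_kernel_mul_log {f : ι → Ω → ℂ} (hm : ∀ j, Measurable (f j))
    (hf : ∀ i s, ‖f i s‖ ≤ 9 * w i s) (i : ι) (s : Ω) (j : ι) :
    Integrable (fun y => K i s j y * Complex.log (1 - f j y)) ν := by
  refine ((h.integrable j).const_mul 18).mono' ?_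
    (Eventually.of_forall (h.norm_kernel_mul_log_le hf i s j))
  have : Measurable fun y => K i s j y := (h.measurable_kernel i j).comp measurable_prodMk_left
  exact (this.mul (Complex.measurable_log.comp ((hm j).const_sub 1))).aestronglyMeasurable

theorem norm_exponent_le {f : ι → Ω → ℂ} (hf : ∀ i s, ‖f i s‖ ≤ 9 * w i s) (i : ι) (s : Ω) :
    ‖exponent ν K f i s‖ ≤ 1 / 2 := by
  calc ‖exponent ν K f i s‖ ≤ ∑ j, 18 * ∫ y, κ y * w j y ∂ν := by
        refine norm_sum_le_of_le _ fun j _ => ?_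
        rw [← integral_const_mul]
        exact norm_integral_le_of_norm_le ((h.integrable j).const_mul 18)
          (Eventually.of_forall (h.norm_kernel_mul_log_le hf i s j))
    _ ≤ 1 / 2 := by
        rw [← Finset.mul_sum]
        linarith [h.sum_le]

theorem norm_exponent_sub_le {f f' : ι → Ω → ℂ} (hf : ∀ i s, ‖f i s‖ ≤ 9 * w i s)
    (hf' : ∀ i s, ‖f' i s‖ ≤ 9 * w i s)
    (hi : ∀ i s j, Integrable (fun y => K i s j y * Complex.log (1 - f j y)) ν)
    (hi' : ∀ i s j, Integrable (fun y => K i s j y * Complex.log (1 - f' j y)) ν) {D : ℝ}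
    (hD0 : 0 ≤ D) (hD : ∀ i s, ‖f i s - f' i s‖ ≤ D * (9 * w i s)) (i : ι) (s : Ω) :
    ‖exponent ν K f i s - exponent ν K f' i s‖ ≤ D / 2 := by
  calc ‖exponent ν K f i s - exponent ν K f' i s‖ ≤ ∑ j, (18 * D) * ∫ y, κ y * w j y ∂ν := by
        rw [exponent, exponent, ← Finset.sum_sub_distrib]
        refine norm_sum_le_of_le _ fun j _ => ?_
        rw [← integral_const_mul, ← integral_sub (hi i s j) (hi' i s j)]
        refine norm_integral_le_of_norm_le ((h.integrable j).const_mul _)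
          (Eventually.of_forall fun y => ?_)
        rw [← mul_sub, norm_mul]
        calc ‖K i s j y‖ * ‖Complex.log (1 - f j y) - Complex.log (1 - f' j y)‖
            ≤ κ y * (2 * (D * (9 * w j y))) := by
              gcongr
              · exact (norm_nonneg _).trans (h.kernel_le i s j y)
              · exact h.kernel_le i s j y
              · exact (norm_log_one_sub_sub_le (h.norm_le_half hf j y)
                  (h.norm_le_half hf' j y)).trans
                  (mul_le_mul_of_nonneg_left (hD j y) (by norm_num))
          _ = 18 * D * (κ y * w j y) := by ring
    _ ≤ D / 2 := by
        rw [← Finset.mul_sum]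
        nlinarith [h.sum_le]

theorem measurable_dressed {e : ι → ℂ} {g : ι → Ω → ℂ} (hg : ∀ i, Measurable (g i)) (i : ι) :
    Measurable (dressed e w g i) :=
  ((Complex.measurable_ofReal.comp (h.measurable_weight i)).const_mul (e i)).mul
    (Complex.measurable_exp.comp (hg i))

theorem measurable_exponent [SFinite ν] {f : ι → Ω → ℂ} (hf : ∀ i, Measurable (f i)) (i : ι) :
    Measurable (exponent ν K f i) := by
  refine Finset.measurable_sum _ fun j _ => ?_
  refine StronglyMeasurable.measurable (StronglyMeasurable.integral_prod_right
    (f := fun s y => K i s j y * Complex.log (1 - f j y)) (Measurable.stronglyMeasurable ?_))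
  exact (h.measurable_kernel i j).mul
    (Complex.measurable_log.comp (((hf j).comp measurable_snd).const_sub 1))

/-- Applying the contraction estimate repeatedly to the two exponents makes their distance at most 2
· 2⁻ⁿ for every n. Measurability of `f` and `f'` is not required: for a prescribed solution only
integrability of the integrands is at hand. -/
theorem unique {e : ι → ℂ} (he : ∀ i, ‖e i‖ ≤ 3) {f f' : ι → Ω → ℂ}
    (hf : ∀ i s, ‖f i s‖ ≤ 9 * w i s) (hf' : ∀ i s, ‖f' i s‖ ≤ 9 * w i s)
    (hi : ∀ i s j, Integrable (fun y => K i s j y * Complex.log (1 - f j y)) ν)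
    (hi' : ∀ i s j, Integrable (fun y => K i s j y * Complex.log (1 - f' j y)) ν)
    (heq : f = dressed e w (exponent ν K f)) (heq' : f' = dressed e w (exponent ν K f')) :
    f = f' := by
  have hg : ∀ i s, ‖exponent ν K f i s‖ ≤ 1 := fun i s =>
    (h.norm_exponent_le hf i s).trans (by norm_num)
  have hg' : ∀ i s, ‖exponent ν K f' i s‖ ≤ 1 := fun i s =>
    (h.norm_exponent_le hf' i s).trans (by norm_num)
  have key : ∀ n : ℕ, ∀ i s,
      ‖exponent ν K f i s - exponent ν K f' i s‖ ≤ 2 * (1 / 2) ^ n := by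
    intro n
    induction n with
    | zero =>
      intro i s
      linarith [norm_sub_le (exponent ν K f i s) (exponent ν K f' i s), hg i s, hg' i s]
    | succ n ih =>
      intro i s
      refine (h.norm_exponent_sub_le hf hf' hi hi' (D := 2 * (1 / 2) ^ n) (by positivity)
        (fun i s => ?_) i s).trans_eq (by ring)
      have := h.norm_dressed_sub_le he hg hg' ih i s
      rwa [← heq, ← heq'] at this
  rw [heq, heq']
  congr 1
  funext i s
  rw [← sub_eq_zero, ← norm_le_zero_iff]
  refine ge_of_tendsto' (x := atTop) ?_ fun n => key n i s
  simpa using (tendsto_pow_atTop_nhds_zero_of_lt_one (r := (1 / 2 : ℝ)) (by norm_num)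
    (by norm_num)).const_mul 2

theorem differentiableOn_exponent {U : Set ℂ} (hU : IsOpen U) {f : ℂ → ι → Ω → ℂ}
    (hm : ∀ τ ∈ U, ∀ j, Measurable (f τ j)) (hf : ∀ τ ∈ U, ∀ i s, ‖f τ i s‖ ≤ 9 * w i s)
    (hd : ∀ i s, DifferentiableOn ℂ (fun τ => f τ i s) U) (i : ι) (s : Ω) :
    DifferentiableOn ℂ (fun τ => exponent ν K (f τ) i s) U := by
  unfold exponent
  refine DifferentiableOn.fun_sum fun j _ => ?_
  refine differentiableOn_integral_of_dominated hU
    (fun τ hτ => (h.integrable_kernel_mul_log (hm τ hτ) (hf τ hτ) i s j).aestronglyMeasurable)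
    (fun τ hτ y => h.norm_kernel_mul_log_le (hf τ hτ) i s j y) ((h.integrable j).const_mul 18)
    fun y => ?_
  refine DifferentiableOn.const_mul ?_ _
  exact ((hd j y).const_sub 1).clog fun τ hτ =>
    one_sub_mem_slitPlane (h.norm_le_half (hf τ hτ) j y)

/-- The integral equation has a solution which depends holomorphically on the parameter `τ` of the
coefficients `e`. -/
theorem exists_holomorphic_solution [SFinite ν] {U : Set ℂ} (hU : IsOpen U) {e : ℂ → ι → ℂ}
    (he : ∀ τ ∈ U, ∀ i, ‖e τ i‖ ≤ 3) (hed : ∀ i, DifferentiableOn ℂ (fun τ => e τ i) U) :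
    ∃ f : ℂ → ι → Ω → ℂ, (∀ i s, DifferentiableOn ℂ (fun τ => f τ i s) U) ∧
      ∀ τ ∈ U, (∀ i, Measurable (f τ i)) ∧ (∀ i s, ‖f τ i s‖ ≤ 9 * w i s) ∧
        f τ = dressed (e τ) w (exponent ν K (f τ)) := by
  -- Picard iteration on the exponents, started at 0. All estimates are uniform in `τ ∈ U`, so the
  -- limit inherits holomorphy.
  let G : ℕ → ℂ → ι → Ω → ℂ := fun n τ =>
    (fun g => exponent ν K (dressed (e τ) w g))^[n] 0
  have G0 : ∀ τ, G 0 τ = 0 := fun τ => rfl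
  have GS : ∀ n τ, G (n + 1) τ = exponent ν K (dressed (e τ) w (G n τ)) := fun n τ => by
    simp only [G, Function.iterate_succ_apply']
  have hb : ∀ n, ∀ τ ∈ U, ∀ i s, ‖G n τ i s‖ ≤ 1 := by
    intro n τ hτ
    induction n with
    | zero => simp [G0]
    | succ n ih =>
      intro i s
      rw [GS]
      exact (h.norm_exponent_le (h.norm_dressed_le (he τ hτ) ih) i s).trans (by norm_num)
  have hm : ∀ n, ∀ τ ∈ U, ∀ i, Measurable (G n τ i) := by
    intro n τ hτ
    induction n with
    | zero => exact fun i => measurable_const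
    | succ n ih =>
      rw [GS]
      exact h.measurable_exponent (h.measurable_dressed ih)
  have hdd : ∀ g : ℂ → ι → Ω → ℂ, (∀ i s, DifferentiableOn ℂ (fun τ => g τ i s) U) →
      ∀ i s, DifferentiableOn ℂ (fun τ => dressed (e τ) w (g τ) i s) U := fun g hg i s =>
    ((hed i).mul_const _).mul (hg i s).cexp
  have hd : ∀ n i s, DifferentiableOn ℂ (fun τ => G n τ i s) U := by
    intro n
    induction n with
    | zero => exact fun i s => differentiableOn_const 0
    | succ n ih =>
      simp only [GS]
      exact h.differentiableOn_exponent hU (fun τ hτ => h.measurable_dressed (hm n τ hτ))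
        (fun τ hτ => h.norm_dressed_le (he τ hτ) (hb n τ hτ)) (hdd _ ih)
  have hstep : ∀ τ ∈ U, ∀ g g' : ι → Ω → ℂ, (∀ i, Measurable (g i)) → (∀ i, Measurable (g' i)) →
      (∀ i s, ‖g i s‖ ≤ 1) → (∀ i s, ‖g' i s‖ ≤ 1) → ∀ D : ℝ, 0 ≤ D →
      (∀ i s, ‖g i s - g' i s‖ ≤ D) → ∀ i s, ‖exponent ν K (dressed (e τ) w g) i s -
        exponent ν K (dressed (e τ) w g') i s‖ ≤ D / 2 := by
    intro τ hτ g g' hgm hgm' hg hg' D hD0 hD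
    have h1 := h.norm_dressed_le (he τ hτ) hg
    have h2 := h.norm_dressed_le (he τ hτ) hg'
    exact h.norm_exponent_sub_le h1 h2
      (h.integrable_kernel_mul_log (h.measurable_dressed hgm) h1)
      (h.integrable_kernel_mul_log (h.measurable_dressed hgm') h2) hD0
      (h.norm_dressed_sub_le (he τ hτ) hg hg' hD)
  have hc : ∀ n, ∀ τ ∈ U, ∀ i s, ‖G n τ i s - G (n + 1) τ i s‖ ≤ 1 * (1 / 2) ^ n := by
    intro n τ hτ
    induction n with
    | zero =>
      intro i s
      simpa [G0] using hb 1 τ hτ i s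
    | succ n ih =>
      intro i s
      rw [GS n, GS (n + 1)]
      refine (hstep τ hτ _ _ (hm n τ hτ) (hm (n + 1) τ hτ) (hb n τ hτ) (hb (n + 1) τ hτ) _
        (by positivity) ih i s).trans_eq (by ring)
  have hex : ∀ τ i s, ∃ g : ℂ, τ ∈ U → Tendsto (fun n => G n τ i s) atTop (𝓝 g) := by
    intro τ i s
    by_cases hτ : τ ∈ U
    · obtain ⟨g, hg⟩ := cauchySeq_tendsto_of_complete
        (cauchySeq_of_le_geometric (f := fun n => G n τ i s) (1 / 2) 1 (by norm_num)
          fun n => by rw [dist_eq_norm]; exact hc n τ hτ i s)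
      exact ⟨g, fun _ => hg⟩
    · exact ⟨0, fun hτ' => absurd hτ' hτ⟩
  choose g hg using hex
  have hgG : ∀ n, ∀ τ ∈ U, ∀ i s, ‖G n τ i s - g τ i s‖ ≤ 2 * (1 / 2) ^ n := by
    intro n τ hτ i s
    have := dist_le_of_le_geometric_of_tendsto (f := fun n => G n τ i s) (1 / 2) 1 (by norm_num)
      (fun n => by rw [dist_eq_norm]; exact hc n τ hτ i s) (hg τ i s hτ) n
    rw [dist_eq_norm] at this
    exact this.trans_eq (by ring)
  have hpow : Tendsto (fun n : ℕ => 2 * (1 / 2 : ℝ) ^ n) atTop (𝓝 0) := by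
    simpa using (tendsto_pow_atTop_nhds_zero_of_lt_one (r := (1 / 2 : ℝ)) (by norm_num)
      (by norm_num)).const_mul 2
  have hgb : ∀ τ ∈ U, ∀ i s, ‖g τ i s‖ ≤ 1 := fun τ hτ i s =>
    le_of_tendsto' (hg τ i s hτ).norm fun n => hb n τ hτ i s
  have hgm : ∀ τ ∈ U, ∀ i, Measurable (g τ i) := fun τ hτ i =>
    measurable_of_tendsto_metrizable (fun n => hm n τ hτ i)
      (tendsto_pi_nhds.2 fun s => hg τ i s hτ)
  have hgd : ∀ i s, DifferentiableOn ℂ (fun τ => g τ i s) U := by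
    intro i s
    refine TendstoLocallyUniformlyOn.differentiableOn (F := fun n τ => G n τ i s) (φ := atTop)
      (TendstoUniformlyOn.tendstoLocallyUniformlyOn ?_) (Eventually.of_forall fun n => hd n i s) hU
    rw [Metric.tendstoUniformlyOn_iff]
    intro ε hε
    filter_upwards [hpow.eventually_lt_const hε] with n hn τ hτ
    rw [dist_comm, dist_eq_norm]
    exact (hgG n τ hτ i s).trans_lt hn
  have hfix : ∀ τ ∈ U, exponent ν K (dressed (e τ) w (g τ)) = g τ := by
    intro τ hτ
    funext i s
    refine tendsto_nhds_unique ?_ ((tendsto_add_atTop_iff_nat 1).2 (hg τ i s hτ))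
    rw [tendsto_iff_norm_sub_tendsto_zero]
    have hpow2 := hpow.div_const 2
    rw [zero_div] at hpow2
    refine squeeze_zero (fun n => norm_nonneg _) (fun n => ?_) hpow2
    rw [GS]
    exact hstep τ hτ _ _ (hm n τ hτ) (hgm τ hτ) (hb n τ hτ) (hgb τ hτ) _ (by positivity)
      (hgG n τ hτ) i s
  refine ⟨fun τ => dressed (e τ) w (g τ), hdd g hgd, fun τ hτ =>
    ⟨h.measurable_dressed (hgm τ hτ), h.norm_dressed_le (he τ hτ) (hgb τ hτ), ?_⟩⟩
  rw [hfix τ hτ]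

end IsContractive

end FixedPoint

/-! ### From equivariant maps of the line to diffeomorphisms of the circle -/

section CircleDiffeo

theorem exp_comp_arg {Q : ℝ → ℝ} (hQ : ∀ θ, Q (θ + 2 * Real.pi) = Q θ + 2 * Real.pi) (θ : ℝ) :
    Circle.exp (Q (Complex.arg (Circle.exp θ))) = Circle.exp (Q θ) := by
  have hper : Function.Periodic (fun θ => Circle.exp (Q θ)) (2 * Real.pi) := fun θ => by
    simp only [hQ, Circle.exp_add_two_pi]
  obtain ⟨m, hm⟩ := Circle.exp_eq_exp.1 (Circle.exp_arg (Circle.exp θ))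
  rw [hm]
  exact hper.int_mul m θ

/-- The jump of `arg` at -1 is harmless: by equivariance `arg z` may be replaced by `θ₀ + arg (z₀⁻¹
z)`, which is smooth near `z₀`. -/
theorem contMDiff_exp_comp_arg {Q : ℝ → ℝ} (hQ : ContDiff ℝ ∞ Q)
    (hper : ∀ θ, Q (θ + 2 * Real.pi) = Q θ + 2 * Real.pi) :
    ContMDiff (𝓡 1) (𝓡 1) ∞ fun z : Circle => Circle.exp (Q (Complex.arg z)) := by
  intro z₀
  set θ₀ := Complex.arg z₀
  have hz₀ : Circle.exp θ₀ = z₀ := Circle.exp_arg z₀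
  have heq : (fun z : Circle => Circle.exp (Q (Complex.arg z))) = fun z : Circle =>
      Circle.exp (Q (θ₀ + (Complex.log (z₀⁻¹ * z : Circle)).im)) := by
    funext z
    have hz : z = Circle.exp (θ₀ + Complex.arg (z₀⁻¹ * z : Circle)) := by
      rw [Circle.exp_add, hz₀, Circle.exp_arg, mul_inv_cancel_left]
    rw [Complex.log_im]
    conv_lhs => rw [hz]
    exact exp_comp_arg hper _
  rw [heq]
  have h1 : ContMDiffAt (𝓡 1) 𝓘(ℝ, ℂ) ∞ (fun z : Circle => ((z₀⁻¹ * z : Circle) : ℂ)) z₀ := by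
    have : ContMDiff (𝓡 1) (𝓡 1) ∞ fun z : Circle => z₀⁻¹ * z := contMDiff_mul_left
    have hfact : Fact (Module.finrank ℝ ℂ = 1 + 1) := finrank_real_complex_fact'
    exact (contMDiff_coe_sphere (E := ℂ) (n := 1)).comp this z₀
  have h2 : ContDiffAt ℝ ∞ (fun x : ℂ => Q (θ₀ + (Complex.log x).im))
      ((z₀⁻¹ * z₀ : Circle) : ℂ) := by
    have hl : ContDiffAt ℝ ∞ Complex.log ((z₀⁻¹ * z₀ : Circle) : ℂ) := by
      rw [inv_mul_cancel, Circle.coe_one]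
      exact (Complex.contDiffAt_log Complex.one_mem_slitPlane).restrict_scalars ℝ
    exact hQ.contDiffAt.comp _ (contDiffAt_const.add
      (Complex.imCLM.contDiff.contDiffAt.comp _ hl))
  have h3 : ContMDiffAt (𝓡 1) 𝓘(ℝ, ℝ) ∞
      (fun z : Circle => Q (θ₀ + (Complex.log (z₀⁻¹ * z : Circle)).im)) z₀ :=
    ContDiffAt.comp_contMDiffAt (f := fun z : Circle => ((z₀⁻¹ * z : Circle) : ℂ)) h2 h1
  exact contMDiff_circleExp.contMDiffAt.comp z₀ h3

/-- Q is increasing, and onto because it shifts by multiples of 2π. Its inverse is smooth by the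
inverse function theorem and has the same equivariance, so both descend. -/
theorem inducesCircleDiffeo_of_deriv_pos {Q : ℝ → ℝ} (hQ : ContDiff ℝ ∞ Q)
    (hper : ∀ θ, Q (θ + 2 * Real.pi) = Q θ + 2 * Real.pi) (hpos : ∀ θ, 0 < deriv Q θ) :
    InducesCircleDiffeo Q := by
  have hmono : StrictMono Q := strictMono_of_deriv_pos hpos
  have hnat : ∀ n : ℕ, ∀ θ, Q (θ + n * (2 * Real.pi)) = Q θ + n * (2 * Real.pi) := by
    intro n θ
    induction n with
    | zero => simp
    | succ n ih =>
      push_cast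
      rw [show θ + ((n : ℝ) + 1) * (2 * Real.pi) = θ + n * (2 * Real.pi) + 2 * Real.pi by ring,
        hper, ih]
      ring
  have hnat' : ∀ n : ℕ, ∀ θ, Q (θ - n * (2 * Real.pi)) = Q θ - n * (2 * Real.pi) := by
    intro n θ
    have := hnat n (θ - n * (2 * Real.pi))
    rw [sub_add_cancel] at this
    linarith
  have hsurj : Function.Surjective Q := by
    intro y
    obtain ⟨n, hn⟩ := exists_nat_gt (|y - Q 0| / (2 * Real.pi))
    rw [div_lt_iff₀ Real.two_pi_pos] at hn
    have h1 := hnat n 0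
    have h2 := hnat' n 0
    have hab : (0 : ℝ) - n * (2 * Real.pi) ≤ 0 + n * (2 * Real.pi) := by
      have : 0 ≤ (n : ℝ) * (2 * Real.pi) := by positivity
      linarith
    obtain ⟨x, -, hx⟩ := intermediate_value_Icc hab hQ.continuous.continuousOn
      (show y ∈ Icc _ _ by
        rw [h1, h2]
        constructor <;> linarith [le_abs_self (y - Q 0), neg_abs_le (y - Q 0)])
    exact ⟨x, hx⟩
  let o : ℝ ≃o ℝ := hmono.orderIsoOfSurjective Q hsurj
  have ho : ∀ x, o x = Q x := fun x => rfl
  let P : ℝ → ℝ := o.symm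
  have hPQ : ∀ x, P (Q x) = x := fun x => o.symm_apply_apply x
  have hQP : ∀ x, Q (P x) = x := fun x => o.apply_symm_apply x
  have hPper : ∀ θ, P (θ + 2 * Real.pi) = P θ + 2 * Real.pi := fun θ =>
    hmono.injective (by rw [hper, hQP, hQP])
  have hP : ContDiff ℝ ∞ P := by
    rw [contDiff_iff_contDiffAt]
    intro x
    exact o.toHomeomorph.toOpenPartialHomeomorph.contDiffAt_symm_deriv (a := x)
      (f₀' := deriv Q (P x)) (hpos _).ne' (mem_univ _)
      (hQ.differentiable (by simp) _).hasDerivAt hQ.contDiffAt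
  refine ⟨hQ, hper, ⟨⟨⟨fun z => Circle.exp (Q (Complex.arg z)),
    fun z => Circle.exp (P (Complex.arg z)), fun z => ?_, fun z => ?_⟩,
    contMDiff_exp_comp_arg hQ hper, contMDiff_exp_comp_arg hP hPper⟩, exp_comp_arg hper⟩⟩
  · simp only [exp_comp_arg hPper, hPQ, Circle.exp_arg]
  · simp only [exp_comp_arg hper, hQP, Circle.exp_arg]

end CircleDiffeo

/-! ### Geometry of the rays and size of the semiflat functions -/

section Rays

/-- Lebesgue measure on the half-line which parametrises the BPS rays. -/
noncomputable abbrev halfLine : Measure (Ioi (0 : ℝ)) := Measure.comap Subtype.val volume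

instance sigmaFinite_halfLine : SigmaFinite halfLine := by
  refine SigmaFinite.of_map halfLine measurable_subtype_coe.aemeasurable ?_
  rw [map_comap_subtype_coe measurableSet_Ioi]
  infer_instance

/-- The absolute value of the semiflat function on its BPS ray, for real `θ`. -/
noncomputable def rayWeight (R : ℝ) (Z : ℂ × ℂ) (γ : Charge) (s : ℝ) : ℝ :=
  Real.exp (-(Real.pi * R * ‖centralCharge Z γ‖ * (s + s⁻¹)))

/-- The factor `exp (i θ_γ)` of the semiflat function, for a complex value `τ` of `θ_m`. -/
noncomputable def phase (θe : ℝ) (τ : ℂ) (γ : Charge) : ℂ :=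
  Complex.exp (Complex.I * (γ.1 * θe + γ.2 * τ + Real.pi * (γ.1 * γ.2)))

/-- The kernel of the integral equation, restricted to the BPS rays. -/
noncomputable def rayKernel (Z : ℂ × ℂ) (γ : Charge) (s : ℝ) (γ' : Charge) (y : ℝ) : ℂ :=
  -(1 / (4 * Real.pi * Complex.I)) * ((pairing γ γ' : ℂ) * ((y : ℂ)⁻¹ *
    ((rayPoint (centralCharge Z γ') y + rayPoint (centralCharge Z γ) s) /
      (rayPoint (centralCharge Z γ') y - rayPoint (centralCharge Z γ) s))))

theorem Xsf_rayPoint {R : ℝ} {Z : ℂ × ℂ} {γ : Charge} (hZ : centralCharge Z γ ≠ 0) (θe θm : ℝ)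
    {s : ℝ} (hs : 0 < s) :
    Xsf R Z θe θm γ (rayPoint (centralCharge Z γ) s) = phase θe θm γ * rayWeight R Z γ s := by
  have hn : ((‖centralCharge Z γ‖ : ℝ) : ℂ) ≠ 0 :=
    Complex.ofReal_ne_zero.2 (norm_ne_zero_iff.2 hZ)
  have hs' : (s : ℂ) ≠ 0 := Complex.ofReal_ne_zero.2 hs.ne'
  have h1 : Real.pi * R * centralCharge Z γ / rayPoint (centralCharge Z γ) s
      = -(Real.pi * R * ‖centralCharge Z γ‖ * (s : ℂ)⁻¹) := by
    rw [rayPoint]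
    field_simp
  have h2 : Real.pi * R * rayPoint (centralCharge Z γ) s *
      (starRingEnd ℂ) (centralCharge Z γ) = -(Real.pi * R * ‖centralCharge Z γ‖ * (s : ℂ)) := by
    have : Real.pi * R * rayPoint (centralCharge Z γ) s * (starRingEnd ℂ) (centralCharge Z γ)
        = -(Real.pi * R * s * (centralCharge Z γ * (starRingEnd ℂ) (centralCharge Z γ))
          / ‖centralCharge Z γ‖) := by
      rw [rayPoint]
      ring
    rw [this, Complex.mul_conj, Complex.normSq_eq_norm_sq]
    push_cast
    field_simp
  rw [Xsf, h1, h2, phase, rayWeight, Complex.ofReal_exp, ← Complex.exp_add, theta]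
  congr 1
  push_cast
  ring

theorem centralCharge_neg (Z : ℂ × ℂ) (γ : Charge) :
    centralCharge Z (-γ) = -centralCharge Z γ := by
  simp only [centralCharge, Prod.fst_neg, Prod.snd_neg]
  push_cast
  ring

theorem rayPoint_neg (z : ℂ) (s : ℝ) : rayPoint (-z) s = -rayPoint z s := by
  rw [rayPoint, rayPoint, norm_neg, neg_div, mul_neg]

theorem norm_rayPoint {z : ℂ} (hz : z ≠ 0) {s : ℝ} (hs : 0 < s) : ‖rayPoint z s‖ = s := by
  rw [rayPoint, norm_neg, norm_mul, norm_div, Complex.norm_real, Complex.norm_real, norm_norm,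
    div_self (norm_ne_zero_iff.2 hz), mul_one, Real.norm_of_nonneg hs.le]

/-- The distance from a point of one ray to the line spanned by the other is `s` times the sine of
their angle; multiplying by conj `z'` makes that line real and leaves this distance as an imaginary
part. -/
theorem abs_im_mul_le_norm_rayPoint_sub {z : ℂ} (hz : z ≠ 0) (z' : ℂ) {s : ℝ} (hs : 0 < s)
    (y : ℝ) : |(z * (starRingEnd ℂ) z').im| * s ≤
      ‖z‖ * ‖z'‖ * ‖rayPoint z' y - rayPoint z s‖ := by
  have hn : 0 < ‖z‖ := norm_pos_iff.2 hz
  have h1 : ((rayPoint z' y - rayPoint z s) * (starRingEnd ℂ) z').im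
      = s / ‖z‖ * (z * (starRingEnd ℂ) z').im := by
    have : (rayPoint z' y - rayPoint z s) * (starRingEnd ℂ) z'
        = ((s / ‖z‖ : ℝ) : ℂ) * (z * (starRingEnd ℂ) z')
          - ((y / ‖z'‖ * Complex.normSq z' : ℝ) : ℂ) := by
      rw [rayPoint, rayPoint]
      push_cast
      rw [← Complex.mul_conj]
      ring
    rw [this, Complex.sub_im, Complex.im_ofReal_mul, Complex.ofReal_im, sub_zero]
  have h2 := Complex.abs_im_le_norm ((rayPoint z' y - rayPoint z s) * (starRingEnd ℂ) z')
  rw [h1, abs_mul, abs_of_pos (div_pos hs hn), norm_mul, Complex.norm_conj, div_mul_eq_mul_div,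
    div_le_iff₀ hn] at h2
  linarith

theorem rayPoint_sub_ne_zero {z z' : ℂ} (h : (z * (starRingEnd ℂ) z').im ≠ 0) {s : ℝ}
    (hs : 0 < s) (y : ℝ) : rayPoint z' y - rayPoint z s ≠ 0 := by
  intro h0
  have hz : z ≠ 0 := by
    rintro rfl
    simp at h
  have := abs_im_mul_le_norm_rayPoint_sub hz z' hs y
  rw [h0, norm_zero, mul_zero] at this
  exact absurd this (not_le.2 (mul_pos (abs_pos.2 h) hs))

theorem im_mul_conj_comm (z z' : ℂ) :
    (z' * (starRingEnd ℂ) z).im = -(z * (starRingEnd ℂ) z').im := by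
  simp only [Complex.mul_im, Complex.conj_im, Complex.conj_re]
  ring

/-- The distance estimate is used from both rays: the denominator dominates `s` and `y` separately,
hence half their sum. -/
theorem norm_rayPoint_div_le {z z' : ℂ} (h : (z * (starRingEnd ℂ) z').im ≠ 0) {s y : ℝ}
    (hs : 0 < s) (hy : 0 < y) :
    ‖(rayPoint z' y + rayPoint z s) / (rayPoint z' y - rayPoint z s)‖ ≤
      2 * (‖z‖ * ‖z'‖) / |(z * (starRingEnd ℂ) z').im| := by
  have hz : z ≠ 0 := by
    rintro rfl
    simp at h
  have hz' : z' ≠ 0 := by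
    rintro rfl
    simp at h
  have h1 := abs_im_mul_le_norm_rayPoint_sub hz z' hs y
  have h2 := abs_im_mul_le_norm_rayPoint_sub hz' z hy s
  rw [im_mul_conj_comm, abs_neg, norm_sub_rev] at h2
  have h3 : ‖rayPoint z' y + rayPoint z s‖ ≤ y + s := by
    simpa only [norm_rayPoint hz hs, norm_rayPoint hz' hy] using
      norm_add_le (rayPoint z' y) (rayPoint z s)
  rw [norm_div, div_le_div_iff₀ (norm_pos_iff.2 (rayPoint_sub_ne_zero h hs y)) (abs_pos.2 h)]
  calc ‖rayPoint z' y + rayPoint z s‖ * |(z * (starRingEnd ℂ) z').im|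
      ≤ (y + s) * |(z * (starRingEnd ℂ) z').im| := by gcongr
    _ ≤ _ := by linarith

theorem im_centralCharge_mul_conj (Z : ℂ × ℂ) (γ γ' : Charge) :
    (centralCharge Z γ * (starRingEnd ℂ) (centralCharge Z γ')).im =
      -(pairing γ γ') * (Z.1 * (starRingEnd ℂ) Z.2).im := by
  simp only [centralCharge, pairing, map_add, map_mul, Complex.mul_im, Complex.add_im,
    Complex.add_re, Complex.mul_re, Complex.conj_re, Complex.conj_im, Complex.intCast_re,
    Complex.intCast_im]
  push_cast
  ring

theorem norm_phase_le {θe : ℝ} {τ : ℂ} (hτ : |τ.im| < 1) {γ : Charge} (hγ : |γ.2| ≤ 1) :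
    ‖phase θe τ γ‖ ≤ 3 := by
  have hre : (Complex.I * (γ.1 * θe + γ.2 * τ + Real.pi * (γ.1 * γ.2))).re = -(γ.2 * τ.im) := by
    simp [Complex.mul_re, Complex.mul_im]
  rw [phase, Complex.norm_exp, hre]
  refine (Real.exp_le_exp.2 ?_).trans exp_one_le_three
  have h1 : |(γ.2 : ℝ)| ≤ 1 := by exact_mod_cast hγ
  calc -(γ.2 * τ.im) ≤ |γ.2 * τ.im| := neg_le_abs _
    _ = |(γ.2 : ℝ)| * |τ.im| := abs_mul _ _
    _ ≤ 1 * 1 := mul_le_mul h1 hτ.le (abs_nonneg _) zero_le_one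
    _ = 1 := one_mul 1

theorem norm_phase_ofReal (θe θm : ℝ) (γ : Charge) : ‖phase θe θm γ‖ = 1 := by
  have hre : (Complex.I * (γ.1 * θe + γ.2 * θm + Real.pi * (γ.1 * γ.2))).re = 0 := by
    simp [Complex.mul_re, Complex.mul_im]
  rw [phase, Complex.norm_exp, hre, Real.exp_zero]

theorem phase_add_two_pi (θe : ℝ) (τ : ℂ) (γ : Charge) :
    phase θe (τ + 2 * Real.pi) γ = phase θe τ γ := by
  rw [phase, phase, Complex.exp_eq_exp_iff_exists_int]
  exact ⟨γ.2, by ring⟩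

theorem differentiable_phase (θe : ℝ) (γ : Charge) : Differentiable ℂ fun τ => phase θe τ γ := by
  unfold phase
  fun_prop

theorem rayWeight_pos (R : ℝ) (Z : ℂ × ℂ) (γ : Charge) (s : ℝ) : 0 < rayWeight R Z γ s :=
  Real.exp_pos _

theorem measurable_rayWeight (R : ℝ) (Z : ℂ × ℂ) (γ : Charge) : Measurable (rayWeight R Z γ) := by
  unfold rayWeight
  fun_prop

theorem measurable_rayPoint (z : ℂ) : Measurable (rayPoint z) := by
  unfold rayPoint
  fun_prop

theorem measurable_rayKernel (Z : ℂ × ℂ) (γ γ' : Charge) :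
    Measurable fun p : ℝ × ℝ => rayKernel Z γ p.1 γ' p.2 := by
  have h1 : Measurable fun p : ℝ × ℝ => rayPoint (centralCharge Z γ) p.1 :=
    (measurable_rayPoint _).comp measurable_fst
  have h2 : Measurable fun p : ℝ × ℝ => rayPoint (centralCharge Z γ') p.2 :=
    (measurable_rayPoint _).comp measurable_snd
  exact (((Complex.measurable_ofReal.comp measurable_snd).inv.mul
    ((h2.add h1).div (h2.sub h1))).const_mul _).const_mul _

/-- One unit of `l` is spent on absorbing `s⁻¹` and leaving the integrable factor exp(-s); the other
`l - 1` units give smallness through s + 1/s ≥ 2. -/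
theorem inv_mul_exp_le {l : ℝ} {s : ℝ} (hl : 1 ≤ l) (hs : 0 < s) :
    Real.exp (-(l * (s + s⁻¹))) ≤ Real.exp (-(2 * (l - 1))) ∧
    s⁻¹ * Real.exp (-(l * (s + s⁻¹))) ≤ Real.exp (-(2 * (l - 1))) * Real.exp (-s) := by
  have hi : 0 < s⁻¹ := inv_pos.2 hs
  have h2 : 2 ≤ s + s⁻¹ := by
    have : s * s⁻¹ = 1 := mul_inv_cancel₀ hs.ne'
    nlinarith [sq_nonneg (s - s⁻¹)]
  have h3 : s⁻¹ * Real.exp (-s⁻¹) ≤ 1 := by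
    rw [Real.exp_neg, ← div_eq_mul_inv, div_le_one (Real.exp_pos _)]
    linarith [Real.add_one_le_exp s⁻¹]
  constructor
  · rw [Real.exp_le_exp]
    nlinarith
  · calc s⁻¹ * Real.exp (-(l * (s + s⁻¹)))
        = s⁻¹ * Real.exp (-s⁻¹) * (Real.exp (-((l - 1) * (s + s⁻¹))) * Real.exp (-s)) := by
          rw [mul_assoc, ← Real.exp_add, ← Real.exp_add]
          ring_nf
      _ ≤ 1 * (Real.exp (-(2 * (l - 1))) * Real.exp (-s)) := by
          refine mul_le_mul h3 (mul_le_mul_of_nonneg_right (Real.exp_le_exp.2 ?_)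
            (Real.exp_pos _).le) (by positivity) zero_le_one
          nlinarith
      _ = _ := one_mul _

end Rays

/-! ### Finite checks on the charges -/

section Charges

theorem abs_le_one_of_mem_bpsCharges {c : Chamber} {γ : Charge} (hγ : γ ∈ bpsCharges c) :
    |γ.1| ≤ 1 ∧ |γ.2| ≤ 1 := by
  revert γ
  cases c <;> decide

theorem exists_pairing_ne_zero {c : Chamber} {γ : Charge} (hγ : γ ∈ bpsCharges c) :
    ∃ γ' ∈ bpsCharges c, pairing γ γ' ≠ 0 := by
  revert γ
  cases c <;> decide

theorem abs_pairing_le_one {c : Chamber} {γ γ' : Charge} (hγ : γ ∈ bpsCharges c)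
    (hγ' : γ' ∈ bpsCharges c) : |pairing γ γ'| ≤ 1 := by
  have key : ∀ γ ∈ bpsCharges c, ∀ γ' ∈ bpsCharges c, |pairing γ γ'| ≤ 1 := by
    cases c <;> decide
  exact key γ hγ γ' hγ'

theorem card_bpsCharges_le (c : Chamber) : (bpsCharges c).card ≤ 6 := by
  cases c <;> decide

theorem card_gaugeCharges_le (c : Chamber) : (gaugeCharges c).card ≤ 2 := by
  cases c <;> decide

theorem mem_bpsCharges_of_mem_gaugeCharges {c : Chamber} {γ : Charge} (hγ : γ ∈ gaugeCharges c) :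
    γ ∈ bpsCharges c ∧ -γ ∈ bpsCharges c := by
  revert γ
  cases c <;> decide

theorem norm_centralCharge_le {c : Chamber} {γ : Charge} (hγ : γ ∈ bpsCharges c) {Z : ℂ × ℂ}
    {M : ℝ} (h1 : ‖Z.1‖ ≤ M) (h2 : ‖Z.2‖ ≤ M) : ‖centralCharge Z γ‖ ≤ 2 * M := by
  have hM : 0 ≤ M := (norm_nonneg _).trans h1
  have ha := abs_le_one_of_mem_bpsCharges hγ
  have ha1 : |(γ.1 : ℝ)| ≤ 1 := by exact_mod_cast ha.1
  have ha2 : |(γ.2 : ℝ)| ≤ 1 := by exact_mod_cast ha.2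
  calc ‖centralCharge Z γ‖ ≤ ‖(γ.1 : ℂ) * Z.1‖ + ‖(γ.2 : ℂ) * Z.2‖ := norm_add_le _ _
    _ = |(γ.1 : ℝ)| * ‖Z.1‖ + |(γ.2 : ℝ)| * ‖Z.2‖ := by
        rw [norm_mul, norm_mul, Complex.norm_intCast, Complex.norm_intCast]
    _ ≤ 1 * M + 1 * M := by gcongr
    _ = 2 * M := by ring

end Charges

/-! ### The integral equation on the rays -/

section RayEquation

/-- The estimates for large `R` on which the analysis of the integral equation rests. -/
structure RayBounds (c : Chamber) (R : ℝ) (Z : ℂ × ℂ) (C δ : ℝ) : Prop where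
  wall : (Z.1 * (starRingEnd ℂ) Z.2).im ≠ 0
  ne_zero : ∀ γ ∈ bpsCharges c, centralCharge Z γ ≠ 0
  nonneg : 0 ≤ C
  kernel_le : ∀ γ ∈ bpsCharges c, ∀ γ' ∈ bpsCharges c, pairing γ γ' ≠ 0 → ∀ s y : ℝ, 0 < s →
    0 < y → ‖(rayPoint (centralCharge Z γ') y + rayPoint (centralCharge Z γ) s) /
      (rayPoint (centralCharge Z γ') y - rayPoint (centralCharge Z γ) s)‖ ≤ C
  weight_le : ∀ γ ∈ bpsCharges c, ∀ s : ℝ, 0 < s → rayWeight R Z γ s ≤ 1 / 20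
  inv_mul_weight_le : ∀ γ ∈ bpsCharges c, ∀ s : ℝ, 0 < s →
    s⁻¹ * rayWeight R Z γ s ≤ δ * Real.exp (-s)
  -- At most six charges, and 6 · 1/216 = 1/36.
  contraction : C * δ ≤ 1 / 216
  -- At most two gauge charges with two logarithms each, of size 18δ: 72δ ≤ 1/4.
  small : δ ≤ 1 / 288

theorem exists_rayBounds (c : Chamber) {K : Set (ℂ × ℂ)} (hK : IsCompact K)
    (hwall : ∀ Z ∈ K, (Z.1 * (starRingEnd ℂ) Z.2).im ≠ 0) :
    ∃ R₀ C δ : ℝ, 0 < R₀ ∧ ∀ R, R₀ ≤ R → ∀ Z ∈ K, RayBounds c R Z C δ := by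
  obtain ⟨d, hd, hdK⟩ := hK.exists_forall_le' (f := fun Z : ℂ × ℂ =>
    |(Z.1 * (starRingEnd ℂ) Z.2).im|) (a := 0) (by fun_prop)
    fun Z hZ => abs_pos.2 (hwall Z hZ)
  obtain ⟨M, hM, hMK⟩ := hK.isBounded.exists_pos_norm_le
  have hM1 : ∀ Z ∈ K, ‖Z.1‖ ≤ M := fun Z hZ => (norm_fst_le Z).trans (hMK Z hZ)
  have hM2 : ∀ Z ∈ K, ‖Z.2‖ ≤ M := fun Z hZ => (norm_snd_le Z).trans (hMK Z hZ)
  have him : ∀ Z ∈ K, ∀ γ γ' : Charge, pairing γ γ' ≠ 0 →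
      d ≤ |(centralCharge Z γ * (starRingEnd ℂ) (centralCharge Z γ')).im| := by
    intro Z hZ γ γ' hp
    rw [im_centralCharge_mul_conj, abs_mul, abs_neg]
    have h1 : (1 : ℝ) ≤ |(pairing γ γ' : ℝ)| := by exact_mod_cast Int.one_le_abs hp
    have h2 : d ≤ |(Z.1 * (starRingEnd ℂ) Z.2).im| := hdK Z hZ
    nlinarith
  have hlow : ∀ Z ∈ K, ∀ γ ∈ bpsCharges c, d / (2 * M) ≤ ‖centralCharge Z γ‖ := by
    intro Z hZ γ hγ
    -- A charge that pairs nontrivially with `γ` keeps `Z_γ` away from 0, since |Z_γ||Z_γ'| ≥ d.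
    obtain ⟨γ', hγ', hp⟩ := exists_pairing_ne_zero hγ
    rw [div_le_iff₀ (by positivity)]
    calc d ≤ _ := him Z hZ γ γ' hp
      _ ≤ ‖centralCharge Z γ * (starRingEnd ℂ) (centralCharge Z γ')‖ := Complex.abs_im_le_norm _
      _ = ‖centralCharge Z γ‖ * ‖centralCharge Z γ'‖ := by rw [norm_mul, Complex.norm_conj]
      _ ≤ ‖centralCharge Z γ‖ * (2 * M) := by
          gcongr
          exact norm_centralCharge_le hγ' (hM1 Z hZ) (hM2 Z hZ)
  set C : ℝ := 2 * (2 * M * (2 * M)) / d with hC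
  have hC0 : 0 < C := by positivity
  set δ : ℝ := min (1 / 288) (1 / (216 * C)) with hδ
  have hδ0 : 0 < δ := by positivity
  have hδ1 : δ ≤ 1 / 288 := min_le_left _ _
  have hδ2 : C * δ ≤ 1 / 216 := by
    calc C * δ ≤ C * (1 / (216 * C)) := by gcongr; exact min_le_right _ _
      _ = 1 / 216 := by field_simp
  have hexp : ∀ l, 1 + δ⁻¹ ≤ l → Real.exp (-(2 * (l - 1))) ≤ δ := by
    intro l hl
    have hi : 0 < δ⁻¹ := inv_pos.2 hδ0
    rw [Real.exp_neg]
    refine inv_le_of_inv_le₀ hδ0 ?_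
    linarith [Real.add_one_le_exp (2 * (l - 1))]
  -- This threshold makes πR|Z_γ| ≥ 1 + 1/δ for all charges, which is what `hexp` needs.
  refine ⟨(1 + δ⁻¹) / (Real.pi * (d / (2 * M))), C, δ, by positivity, fun R hR Z hZ => ?_⟩
  have hl : ∀ γ ∈ bpsCharges c, 1 + δ⁻¹ ≤ Real.pi * R * ‖centralCharge Z γ‖ := by
    intro γ hγ
    rw [div_le_iff₀ (by positivity)] at hR
    have hR0 : 0 ≤ R := by
      by_contra hneg
      have : R * (Real.pi * (d / (2 * M))) ≤ 0 :=
        mul_nonpos_of_nonpos_of_nonneg (not_le.1 hneg).le (by positivity)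
      linarith [inv_pos.2 hδ0]
    calc 1 + δ⁻¹ ≤ R * (Real.pi * (d / (2 * M))) := hR
      _ = Real.pi * R * (d / (2 * M)) := by ring
      _ ≤ _ := by
          gcongr
          exact hlow Z hZ γ hγ
  have hl1 : ∀ γ ∈ bpsCharges c, 1 ≤ Real.pi * R * ‖centralCharge Z γ‖ := fun γ hγ => by
    linarith [hl γ hγ, inv_pos.2 hδ0]
  refine ⟨hwall Z hZ, fun γ hγ => ?_, hC0.le, fun γ hγ γ' hγ' hp s y hs hy => ?_,
    fun γ hγ s hs => ?_, fun γ hγ s hs => ?_, hδ2, hδ1⟩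
  · rw [← norm_pos_iff]
    exact lt_of_lt_of_le (by positivity) (hlow Z hZ γ hγ)
  · have h1 := him Z hZ γ γ' hp
    refine (norm_rayPoint_div_le (abs_pos.1 (hd.trans_le h1)) hs hy).trans ?_
    rw [hC]
    gcongr
    · exact norm_centralCharge_le hγ (hM1 Z hZ) (hM2 Z hZ)
    · exact norm_centralCharge_le hγ' (hM1 Z hZ) (hM2 Z hZ)
  · linarith [(inv_mul_exp_le (hl1 γ hγ) hs).1, hexp _ (hl γ hγ),
      show rayWeight R Z γ s = Real.exp (-(Real.pi * R * ‖centralCharge Z γ‖ * (s + s⁻¹))) from rfl]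
  · exact (inv_mul_exp_le (hl1 γ hγ) hs).2.trans
      (mul_le_mul_of_nonneg_right (hexp _ (hl γ hγ)) (Real.exp_pos _).le)

/-- The integral equation for the restrictions of the `X_γ` to their own BPS rays, with the torus
coordinate `θ_m` replaced by a complex number `τ`. -/
structure IsRaySolution (c : Chamber) (R : ℝ) (Z : ℂ × ℂ) (θe : ℝ) (τ : ℂ)
    (f : Charge → ℝ → ℂ) : Prop where
  norm_le : ∀ γ ∈ bpsCharges c, ∀ s : ℝ, 0 < s → ‖f γ s‖ ≤ 9 * rayWeight R Z γ s
  integrable : ∀ γ ∈ bpsCharges c,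
    IntegrableOn (fun s : ℝ => (s : ℂ)⁻¹ * Complex.log (1 - f γ s)) (Ioi 0)
  equation : ∀ γ ∈ bpsCharges c, ∀ s : ℝ, 0 < s → f γ s = phase θe τ γ * rayWeight R Z γ s *
    Complex.exp (∑ γ' ∈ bpsCharges c, ∫ y in Ioi (0 : ℝ),
      rayKernel Z γ s γ' y * Complex.log (1 - f γ' y))

theorem sum_integral_rayKernel (c : Chamber) (Z : ℂ × ℂ) (f : Charge → ℝ → ℂ) (γ : Charge)
    (s : ℝ) :
    ∑ γ' ∈ bpsCharges c, ∫ y in Ioi (0 : ℝ), rayKernel Z γ s γ' y * Complex.log (1 - f γ' y) =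
      -(1 / (4 * Real.pi * Complex.I)) * ∑ γ' ∈ bpsCharges c, (pairing γ γ' : ℂ) *
        ∫ y in Ioi (0 : ℝ), (y : ℂ)⁻¹ *
          ((rayPoint (centralCharge Z γ') y + rayPoint (centralCharge Z γ) s) /
            (rayPoint (centralCharge Z γ') y - rayPoint (centralCharge Z γ) s)) *
          Complex.log (1 - f γ' y) := by
  rw [Finset.mul_sum]
  refine Finset.sum_congr rfl fun γ' _ => ?_
  rw [← integral_const_mul, ← integral_const_mul]
  congr 1
  funext y
  rw [rayKernel]
  ring

theorem rayKernel_eq (γ : Charge) (s : ℝ) (γ' : Charge) (y : ℝ) :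
    rayKernel Z γ s γ' y = -(1 / (4 * Real.pi * Complex.I)) * ((pairing γ γ' : ℂ) *
      ((rayPoint (centralCharge Z γ') y + rayPoint (centralCharge Z γ) s) /
        (rayPoint (centralCharge Z γ') y - rayPoint (centralCharge Z γ) s))) * (y : ℂ)⁻¹ := by
  rw [rayKernel]
  ring

theorem exponent_eq (c : Chamber) (Z : ℂ × ℂ) (f : Charge → ℝ → ℂ) (γ : bpsCharges c) (s : Ioi (0 : ℝ)) :
    exponent (ι := bpsCharges c) (Ω := Ioi (0 : ℝ)) halfLine
      (fun γ s γ' y => rayKernel Z γ s γ' y) (fun γ s => f γ s) γ s =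
    ∑ γ' ∈ bpsCharges c, ∫ y in Ioi (0 : ℝ),
      rayKernel Z γ s γ' y * Complex.log (1 - f γ' y) := by
  rw [exponent, ← Finset.sum_coe_sort (bpsCharges c) fun γ' => ∫ y in Ioi (0 : ℝ),
    rayKernel Z γ s γ' y * Complex.log (1 - f γ' y)]
  exact Finset.sum_congr rfl fun γ' _ => integral_subtype_comap measurableSet_Ioi
    fun y : ℝ => rayKernel Z γ s γ' y * Complex.log (1 - f γ' y)

namespace RayBounds

variable {c : Chamber} {R : ℝ} {Z : ℂ × ℂ} {C δ : ℝ} (h : RayBounds c R Z C δ)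
include h

theorem im_ne_zero {γ γ' : Charge} (hp : pairing γ γ' ≠ 0) :
    (centralCharge Z γ * (starRingEnd ℂ) (centralCharge Z γ')).im ≠ 0 := by
  rw [im_centralCharge_mul_conj]
  exact mul_ne_zero (neg_ne_zero.2 (Int.cast_ne_zero.2 hp)) h.wall

theorem rayPoint_notMem_bpsRay {γ γ' : Charge} (hp : pairing γ γ' ≠ 0) {s : ℝ} (hs : 0 < s) :
    rayPoint (centralCharge Z γ) s ∉ bpsRay Z γ' := by
  rintro ⟨y, -, hy⟩
  exact rayPoint_sub_ne_zero (h.im_ne_zero hp) hs y (sub_eq_zero.2 hy.symm)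

theorem norm_coefficient_le {γ γ' : Charge} (hγ : γ ∈ bpsCharges c) (hγ' : γ' ∈ bpsCharges c)
    {s y : ℝ} (hs : 0 < s) (hy : 0 < y) :
    ‖-(1 / (4 * Real.pi * Complex.I)) * ((pairing γ γ' : ℂ) *
      ((rayPoint (centralCharge Z γ') y + rayPoint (centralCharge Z γ) s) /
        (rayPoint (centralCharge Z γ') y - rayPoint (centralCharge Z γ) s)))‖ ≤ C := by
  by_cases hp : pairing γ γ' = 0
  · simpa [hp] using h.nonneg
  have h1 : ‖-(1 / (4 * Real.pi * Complex.I))‖ ≤ 1 := by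
    rw [norm_neg, norm_div, norm_one, norm_mul, norm_mul, Complex.norm_I, Complex.norm_real,
      Real.norm_of_nonneg Real.pi_pos.le, Complex.norm_ofNat,
      div_le_one (by linarith [Real.pi_gt_three])]
    linarith [Real.pi_gt_three]
  have h2 : ‖(pairing γ γ' : ℂ)‖ ≤ 1 := by
    rw [Complex.norm_intCast]
    exact_mod_cast abs_pairing_le_one hγ hγ'
  rw [norm_mul, norm_mul]
  calc _ ≤ 1 * (1 * C) := by
        gcongr
        exact h.kernel_le γ hγ γ' hγ' hp s y hs hy
    _ = C := by ring

theorem integrableOn_weight {γ : Charge} (hγ : γ ∈ bpsCharges c) :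
    IntegrableOn (fun y => y⁻¹ * rayWeight R Z γ y) (Ioi 0) := by
  refine ((integrableOn_exp_neg_Ioi 0).const_mul δ).mono'
    (measurable_id.inv.mul (measurable_rayWeight R Z γ)).aestronglyMeasurable ?_
  filter_upwards [ae_restrict_mem measurableSet_Ioi] with y hy
  have hy : 0 < y := hy
  rw [Real.norm_of_nonneg (mul_nonneg (inv_pos.2 hy).le (rayWeight_pos R Z γ y).le)]
  exact h.inv_mul_weight_le γ hγ y hy

theorem integral_weight_le {γ : Charge} (hγ : γ ∈ bpsCharges c) :
    ∫ y in Ioi (0 : ℝ), y⁻¹ * rayWeight R Z γ y ≤ δ := by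
  calc ∫ y in Ioi (0 : ℝ), y⁻¹ * rayWeight R Z γ y ≤ ∫ y in Ioi (0 : ℝ), δ * Real.exp (-y) :=
        setIntegral_mono_on (h.integrableOn_weight hγ)
          ((integrableOn_exp_neg_Ioi 0).const_mul δ) measurableSet_Ioi
          fun y hy => h.inv_mul_weight_le γ hγ y hy
    _ = δ := by rw [integral_const_mul, integral_exp_neg_Ioi_zero, mul_one]

theorem sum_integral_weight_le :
    ∑ γ : bpsCharges c, ∫ y : Ioi (0 : ℝ), C * (y : ℝ)⁻¹ * rayWeight R Z γ y ∂halfLine ≤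
      1 / 36 := by
  have h1 : ∀ γ : bpsCharges c,
      ∫ y : Ioi (0 : ℝ), C * (y : ℝ)⁻¹ * rayWeight R Z γ y ∂halfLine ≤ 1 / 216 := by
    intro γ
    rw [integral_subtype_comap measurableSet_Ioi fun y : ℝ => C * y⁻¹ * rayWeight R Z γ y]
    simp only [mul_assoc]
    rw [integral_const_mul]
    exact (mul_le_mul_of_nonneg_left (h.integral_weight_le γ.2) h.nonneg).trans h.contraction
  refine (Finset.sum_le_card_nsmul _ _ _ fun γ _ => h1 γ).trans ?_
  rw [Finset.card_univ, Fintype.card_coe, nsmul_eq_mul]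
  have : ((bpsCharges c).card : ℝ) ≤ 6 := by exact_mod_cast card_bpsCharges_le c
  linarith

theorem integrable_kernelBound_mul_weight (γ : bpsCharges c) :
    Integrable (fun y : Ioi (0 : ℝ) => C * (y : ℝ)⁻¹ * rayWeight R Z γ y) halfLine := by
  refine (integrableOn_iff_comap_subtypeVal
    (f := fun y : ℝ => C * y⁻¹ * rayWeight R Z γ y) measurableSet_Ioi).1 ?_
  simpa only [mul_assoc, IntegrableOn] using (h.integrableOn_weight γ.2).const_mul C

theorem norm_rayKernel_le (γ : bpsCharges c) (s : Ioi (0 : ℝ)) (γ' : bpsCharges c)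
    (y : Ioi (0 : ℝ)) : ‖rayKernel Z γ s γ' y‖ ≤ C * (y : ℝ)⁻¹ := by
  have hy : 0 < (y : ℝ) := y.2
  rw [rayKernel_eq, norm_mul, norm_inv, Complex.norm_real, Real.norm_of_nonneg hy.le]
  exact mul_le_mul_of_nonneg_right (h.norm_coefficient_le γ.2 γ'.2 s.2 hy) (inv_pos.2 hy).le

theorem isContractive : IsContractive (ι := bpsCharges c) (Ω := Ioi (0 : ℝ)) halfLine
    (fun γ s γ' y => rayKernel Z γ s γ' y) (fun y => C * (y : ℝ)⁻¹)
    (fun γ s => rayWeight R Z γ s) where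
  measurable_kernel γ γ' := (measurable_rayKernel Z γ γ').comp
    (f := fun p : Ioi (0 : ℝ) × Ioi (0 : ℝ) => ((p.1 : ℝ), (p.2 : ℝ)))
    ((measurable_subtype_coe.comp measurable_fst).prodMk
      (measurable_subtype_coe.comp measurable_snd))
  kernel_le := h.norm_rayKernel_le
  measurable_weight γ := (measurable_rayWeight R Z γ).comp measurable_subtype_coe
  weight_nonneg γ s := (rayWeight_pos R Z γ s).le
  weight_le γ s := h.weight_le γ γ.2 s s.2
  integrable := h.integrable_kernelBound_mul_weight
  sum_le := h.sum_integral_weight_le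

theorem integrable_rayKernel_mul_log {f : Charge → ℝ → ℂ} (hf : ∀ γ ∈ bpsCharges c,
    IntegrableOn (fun s : ℝ => (s : ℂ)⁻¹ * Complex.log (1 - f γ s)) (Ioi 0))
    (γ : bpsCharges c) (s : Ioi (0 : ℝ)) (γ' : bpsCharges c) :
    Integrable (fun y : Ioi (0 : ℝ) => rayKernel Z γ s γ' y * Complex.log (1 - f γ' y))
      halfLine := by
  refine (integrableOn_iff_comap_subtypeVal
    (f := fun y : ℝ => rayKernel Z γ s γ' y * Complex.log (1 - f γ' y)) measurableSet_Ioi).1 ?_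
  simp only [rayKernel_eq, mul_assoc _ (Inv.inv _)]
  refine Integrable.bdd_mul (hf γ' γ'.2) (c := C) ?_ ?_
  · have h1 := measurable_rayPoint (centralCharge Z γ')
    exact ((((h1.add_const _).div (h1.sub_const _)).const_mul _).const_mul _).aestronglyMeasurable
  · filter_upwards [ae_restrict_mem measurableSet_Ioi] with y hy
    exact h.norm_coefficient_le γ.2 γ'.2 s.2 hy

/-- This identifies arbitrarily chosen solutions, for real `τ`, with the holomorphic family. -/
theorem raySolution_unique {θe : ℝ} {τ : ℂ} (hτ : |τ.im| < 1) {f f' : Charge → ℝ → ℂ}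
    (hf : IsRaySolution c R Z θe τ f) (hf' : IsRaySolution c R Z θe τ f') {γ : Charge}
    (hγ : γ ∈ bpsCharges c) {s : ℝ} (hs : 0 < s) : f γ s = f' γ s := by
  have := h.isContractive.unique (e := fun γ => phase θe τ γ)
    (fun γ => norm_phase_le hτ (abs_le_one_of_mem_bpsCharges γ.2).2)
    (f := fun γ s => f γ s) (f' := fun γ s => f' γ s)
    (fun γ s => hf.norm_le γ γ.2 s s.2) (fun γ s => hf'.norm_le γ γ.2 s s.2)
    (h.integrable_rayKernel_mul_log hf.integrable) (h.integrable_rayKernel_mul_log hf'.integrable)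
    (by
      funext γ s
      rw [dressed, exponent_eq]
      exact hf.equation γ γ.2 s s.2)
    (by
      funext γ s
      rw [dressed, exponent_eq]
      exact hf'.equation γ γ.2 s s.2)
  exact congrFun (congrFun this ⟨γ, hγ⟩) ⟨s, hs⟩

theorem norm_inv_mul_log_le {f : Charge → ℝ → ℂ}
    (hf : ∀ γ ∈ bpsCharges c, ∀ s : ℝ, 0 < s → ‖f γ s‖ ≤ 9 * rayWeight R Z γ s) {γ : Charge}
    (hγ : γ ∈ bpsCharges c) {s : ℝ} (hs : 0 < s) :
    ‖f γ s‖ ≤ 1 / 2 ∧ ‖(s : ℂ)⁻¹ * Complex.log (1 - f γ s)‖ ≤ 18 * δ * Real.exp (-s) := by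
  have h1 := hf γ hγ s hs
  have h2 : ‖f γ s‖ ≤ 1 / 2 := by linarith [h.weight_le γ hγ s hs]
  refine ⟨h2, ?_⟩
  rw [norm_mul, norm_inv, Complex.norm_real, Real.norm_of_nonneg hs.le]
  calc s⁻¹ * ‖Complex.log (1 - f γ s)‖ ≤ s⁻¹ * (2 * (9 * rayWeight R Z γ s)) := by
        have := inv_pos.2 hs
        gcongr
        exact (norm_log_one_sub_le h2).trans (mul_le_mul_of_nonneg_left h1 (by norm_num))
    _ = 18 * (s⁻¹ * rayWeight R Z γ s) := by ring
    _ ≤ 18 * (δ * Real.exp (-s)) :=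
        mul_le_mul_of_nonneg_left (h.inv_mul_weight_le γ hγ s hs) (by norm_num)
    _ = _ := by ring

theorem exists_holomorphic_raySolution (θe : ℝ) :
    ∃ F : ℂ → Charge → ℝ → ℂ,
      (∀ γ s, DifferentiableOn ℂ (fun τ => F τ γ s) {τ | |τ.im| < 1}) ∧
      ∀ τ : ℂ, |τ.im| < 1 → (∀ γ, Measurable (F τ γ)) ∧ IsRaySolution c R Z θe τ (F τ) := by
  obtain ⟨f, hfd, hf⟩ := h.isContractive.exists_holomorphic_solution (U := {τ : ℂ | |τ.im| < 1})
    (isOpen_lt (by fun_prop) continuous_const) (e := fun τ γ => phase θe τ γ)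
    (fun τ hτ γ => norm_phase_le hτ (abs_le_one_of_mem_bpsCharges γ.2).2)
    fun γ => (differentiable_phase θe γ).differentiableOn
  let F : ℂ → Charge → ℝ → ℂ := fun τ γ s =>
    if hγ : γ ∈ bpsCharges c then if hs : s ∈ Ioi 0 then f τ ⟨γ, hγ⟩ ⟨s, hs⟩ else 0 else 0
  have hFf : ∀ (τ : ℂ) (γ : bpsCharges c) (s : Ioi (0 : ℝ)), F τ γ s = f τ γ s := by
    intro τ γ s
    simp only [F, dif_pos γ.2, dif_pos s.2]
  have hFf' : ∀ τ : ℂ, (fun (γ : bpsCharges c) (s : Ioi (0 : ℝ)) => F τ γ s) = f τ := fun τ => by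
    funext γ s
    exact hFf τ γ s
  refine ⟨F, fun γ s => ?_, fun τ hτ => ?_⟩
  · by_cases hγ : γ ∈ bpsCharges c
    · by_cases hs : s ∈ Ioi (0 : ℝ)
      · simpa only [F, dif_pos hγ, dif_pos hs] using hfd ⟨γ, hγ⟩ ⟨s, hs⟩
      · simp only [F, dif_neg hs, dite_eq_ite, ite_self]
        exact differentiableOn_const 0
    · simp only [F, dif_neg hγ]
      exact differentiableOn_const 0
  obtain ⟨hm, hb, heq⟩ := hf τ hτ
  have hFm : ∀ γ, Measurable (F τ γ) := by
    intro γ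
    by_cases hγ : γ ∈ bpsCharges c
    · simp only [F, dif_pos hγ]
      exact Measurable.dite (s := Ioi 0) (hm ⟨γ, hγ⟩) measurable_const measurableSet_Ioi
    · simp only [F, dif_neg hγ]
      exact measurable_const
  have hFb : ∀ γ ∈ bpsCharges c, ∀ s : ℝ, 0 < s → ‖F τ γ s‖ ≤ 9 * rayWeight R Z γ s := by
    intro γ hγ s hs
    have := hb ⟨γ, hγ⟩ ⟨s, hs⟩
    rwa [← hFf] at this
  refine ⟨hFm, hFb, fun γ hγ => ?_, fun γ hγ s hs => ?_⟩
  · refine ((integrableOn_exp_neg_Ioi 0).const_mul (18 * δ)).mono' ?_ ?_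
    · exact (Complex.measurable_ofReal.inv.mul
        (Complex.measurable_log.comp ((hFm γ).const_sub 1))).aestronglyMeasurable
    · filter_upwards [ae_restrict_mem measurableSet_Ioi] with y hy
      exact (h.norm_inv_mul_log_le hFb hγ hy).2
  · have := congrFun (congrFun heq ⟨γ, hγ⟩) ⟨s, hs⟩
    rwa [dressed, ← hFf', exponent_eq c Z (F τ) ⟨γ, hγ⟩ ⟨s, hs⟩] at this

/-- The equation may be evaluated on the ray of `γ` because that ray misses all rays with nonzero
pairing. The factor 2 is relaxed to the 9 that also accommodates complex `τ`. -/
theorem isRaySolution {θe θm : ℝ} {X : Charge → ℂ → ℂ} (hX : IsSolution c R Z θe θm X) :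
    IsRaySolution c R Z θe θm fun γ s => X γ (rayPoint (centralCharge Z γ) s) where
  norm_le γ hγ s hs := by
    have := hX.bound γ hγ _ ⟨s, hs, rfl⟩
    rw [Xsf_rayPoint (h.ne_zero γ hγ) θe θm hs, norm_mul, norm_phase_ofReal, one_mul,
      Complex.norm_real, Real.norm_of_nonneg (rayWeight_pos R Z γ s).le] at this
    linarith [rayWeight_pos R Z γ s]
  integrable := hX.integrable
  equation γ hγ s hs := by
    rw [sum_integral_rayKernel c Z (fun γ s => X γ (rayPoint (centralCharge Z γ) s)),
      hX.equation γ (rayPoint (centralCharge Z γ) s) (norm_pos_iff.1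
        (by rwa [norm_rayPoint (h.ne_zero γ hγ) hs]))
        (fun γ' _ hp => h.rayPoint_notMem_bpsRay hp hs), Xsf_rayPoint (h.ne_zero γ hγ) θe θm hs]
    rfl

/-- The right-hand side of the equation, fed with `f`, defines `X` everywhere; on its own ray each
`X γ` gives back `f γ`, so `X` solves the equation itself. -/
theorem exists_isSolution {θe θm : ℝ} {f : Charge → ℝ → ℂ}
    (hf : IsRaySolution c R Z θe θm f) :
    ∃ X : Charge → ℂ → ℂ, IsSolution c R Z θe θm X := by
  let X : Charge → ℂ → ℂ := fun γ ζ => Xsf R Z θe θm γ ζ *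
    Complex.exp (-(1 / (4 * Real.pi * Complex.I)) * ∑ γ' ∈ bpsCharges c, (pairing γ γ' : ℂ) *
      ∫ y in Ioi (0 : ℝ), (y : ℂ)⁻¹ * ((rayPoint (centralCharge Z γ') y + ζ) /
        (rayPoint (centralCharge Z γ') y - ζ)) * Complex.log (1 - f γ' y))
  have hXf : ∀ γ ∈ bpsCharges c, ∀ s ∈ Ioi (0 : ℝ),
      X γ (rayPoint (centralCharge Z γ) s) = f γ s := by
    intro γ hγ s hs
    rw [hf.equation γ hγ s hs, sum_integral_rayKernel, ← Xsf_rayPoint (h.ne_zero γ hγ) θe θm hs]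
  refine ⟨X, ?_, fun γ hγ => ?_, fun γ ζ _ _ => ?_⟩
  · rintro γ hγ _ ⟨s, hs, rfl⟩
    have hE : ‖exponent (ι := bpsCharges c) (Ω := Ioi (0 : ℝ)) halfLine
        (fun γ s γ' y => rayKernel Z γ s γ' y) (fun γ s => f γ s) ⟨γ, hγ⟩ ⟨s, hs⟩‖ ≤ 1 / 2 :=
      h.isContractive.norm_exponent_le (fun γ s => hf.norm_le γ γ.2 s s.2) _ _
    rw [exponent_eq] at hE
    rw [hXf γ hγ s hs, hf.equation γ hγ s hs, ← Xsf_rayPoint (h.ne_zero γ hγ) θe θm hs, norm_mul,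
      mul_comm]
    refine mul_le_mul_of_nonneg_right ?_ (norm_nonneg _)
    refine (Complex.norm_exp_le_exp_norm _).trans ((Real.exp_le_exp.2 hE).trans ?_)
    -- The square of exp(1/2) is e ≤ 3 < 4, which yields the required factor 2.
    have h1 : Real.exp (1 / 2) * Real.exp (1 / 2) = Real.exp 1 := by
      rw [← Real.exp_add]
      norm_num
    nlinarith [exp_one_le_three, Real.exp_pos (1 / 2)]
  · exact (hf.integrable γ hγ).congr_fun (fun s hs => by simp only [hXf γ hγ s hs])
      measurableSet_Ioi
  · have : ∀ γ' ∈ bpsCharges c, rayIntegral Z X γ' ζ = ∫ y in Ioi (0 : ℝ), (y : ℂ)⁻¹ *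
        ((rayPoint (centralCharge Z γ') y + ζ) / (rayPoint (centralCharge Z γ') y - ζ)) *
          Complex.log (1 - f γ' y) := fun γ' hγ' =>
      setIntegral_congr_fun measurableSet_Ioi fun y hy => by simp only [hXf γ' hγ' y hy]
    rw [Finset.sum_congr rfl fun γ' hγ' => by rw [this γ' hγ']]

end RayBounds

end RayEquation

/-! ### The gauge function as the real part of a holomorphic function -/

section Gauge

/-- The integrand of the gauge function with `log |·|` replaced by the complex logarithm. -/
noncomputable def complexGaugeIntegrand (c : Chamber) (f : Charge → ℝ → ℂ) (t : ℝ) : ℂ :=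
  ∑ γ ∈ gaugeCharges c, ((t : ℂ)⁻¹ * Complex.log (1 - f γ t) -
    (t : ℂ)⁻¹ * Complex.log (1 - f (-γ) t))

theorem measurable_complexGaugeIntegrand (c : Chamber) {f : Charge → ℝ → ℂ}
    (hf : ∀ γ, Measurable (f γ)) : Measurable (complexGaugeIntegrand c f) := by
  have h1 : ∀ γ, Measurable fun t : ℝ => (t : ℂ)⁻¹ * Complex.log (1 - f γ t) := fun γ =>
    Complex.measurable_ofReal.inv.mul (Complex.measurable_log.comp ((hf γ).const_sub 1))
  exact Finset.measurable_sum _ fun γ _ => (h1 γ).sub (h1 (-γ))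

namespace RayBounds

variable {c : Chamber} {R : ℝ} {Z : ℂ × ℂ} {C δ : ℝ} (h : RayBounds c R Z C δ)
include h

theorem delta_nonneg : 0 ≤ δ := by
  obtain ⟨γ, hγ⟩ : (bpsCharges c).Nonempty := by cases c <;> decide
  have h1 := h.inv_mul_weight_le γ hγ 1 one_pos
  rw [inv_one, one_mul] at h1
  exact (pos_of_mul_pos_left ((rayWeight_pos R Z γ 1).trans_le h1) (Real.exp_pos _).le).le

theorem norm_complexGaugeIntegrand_le {f : Charge → ℝ → ℂ}
    (hf : ∀ γ ∈ bpsCharges c, ∀ s : ℝ, 0 < s → ‖f γ s‖ ≤ 9 * rayWeight R Z γ s) {t : ℝ}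
    (ht : 0 < t) : ‖complexGaugeIntegrand c f t‖ ≤ 1 / 4 := by
  have hδ := h.delta_nonneg
  have h1 : ∀ γ ∈ gaugeCharges c, ‖(t : ℂ)⁻¹ * Complex.log (1 - f γ t) -
      (t : ℂ)⁻¹ * Complex.log (1 - f (-γ) t)‖ ≤ 36 * δ := by
    intro γ hγ
    obtain ⟨hγ1, hγ2⟩ := mem_bpsCharges_of_mem_gaugeCharges hγ
    have he : Real.exp (-t) ≤ 1 := Real.exp_le_one_iff.2 (by linarith)
    have h2 := (h.norm_inv_mul_log_le hf hγ1 ht).2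
    have h3 := (h.norm_inv_mul_log_le hf hγ2 ht).2
    have h4 : 18 * δ * Real.exp (-t) ≤ 18 * δ * 1 :=
      mul_le_mul_of_nonneg_left he (by positivity)
    exact (norm_sub_le _ _).trans (by linarith)
  refine (norm_sum_le_of_le _ h1).trans ?_
  rw [Finset.sum_const, nsmul_eq_mul]
  have h5 : ((gaugeCharges c).card : ℝ) ≤ 2 := by exact_mod_cast card_gaugeCharges_le c
  nlinarith [h.small]

/-- The point where `X (-γ)` is evaluated lies on the ray of `-γ`, so ψ only sees values on own
rays; and log|w| = Re log w. -/
theorem re_complexGaugeIntegrand {f : Charge → ℝ → ℂ}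
    (hf : ∀ γ ∈ bpsCharges c, ∀ s : ℝ, 0 < s → ‖f γ s‖ ≤ 9 * rayWeight R Z γ s)
    {X : Charge → ℂ → ℂ} (hX : ∀ γ ∈ bpsCharges c, ∀ s : ℝ, 0 < s →
      X γ (rayPoint (centralCharge Z γ) s) = f γ s) {t : ℝ} (ht : 0 < t) :
    gaugeIntegrand c Z X t = (complexGaugeIntegrand c f t).re := by
  rw [gaugeIntegrand, complexGaugeIntegrand, Complex.re_sum, Finset.mul_sum]
  refine Finset.sum_congr rfl fun γ hγ => ?_
  obtain ⟨hγ1, hγ2⟩ := mem_bpsCharges_of_mem_gaugeCharges hγ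
  have hne : ∀ γ ∈ bpsCharges c, ‖1 - f γ t‖ ≠ 0 := fun γ hγ => norm_ne_zero_iff.2
    (Complex.slitPlane_ne_zero (one_sub_mem_slitPlane (h.norm_inv_mul_log_le hf hγ ht).1))
  rw [← rayPoint_neg, ← centralCharge_neg, hX γ hγ1 t ht, hX (-γ) hγ2 t ht, norm_div,
    Real.log_div (hne γ hγ1) (hne (-γ) hγ2), ← mul_sub, ← Complex.ofReal_inv,
    Complex.re_ofReal_mul, Complex.sub_re, Complex.log_re, Complex.log_re]

theorem integrableOn_complexGaugeIntegrand {f : Charge → ℝ → ℂ} (hfm : ∀ γ, Measurable (f γ))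
    (hf : ∀ γ ∈ bpsCharges c, ∀ s : ℝ, 0 < s → ‖f γ s‖ ≤ 9 * rayWeight R Z γ s) :
    IntegrableOn (complexGaugeIntegrand c f) (Ioo 0 1) := by
  refine Measure.integrableOn_of_bounded (M := 1 / 4) (by simp)
    (measurable_complexGaugeIntegrand c hfm).aestronglyMeasurable ?_
  filter_upwards [ae_restrict_mem measurableSet_Ioo] with t ht
  exact h.norm_complexGaugeIntegrand_le hf ht.1

/-- The gauge function is the restriction to the real axis of the real part of a small holomorphic
function of `θ_m`. -/
theorem exists_holomorphic_psi (θe : ℝ) :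
    ∃ H : ℂ → ℂ, DifferentiableOn ℂ H {τ | |τ.im| < 1} ∧
      (∀ τ : ℂ, |τ.im| < 1 → ‖H τ‖ ≤ 1 / 4) ∧
      ∀ (θm : ℝ) (X : Charge → ℂ → ℂ), IsSolution c R Z θe θm X →
        IntegrableOn (gaugeIntegrand c Z X) (Ioo 0 1) ∧ psi c Z X = (H θm).re := by
  obtain ⟨F, hFd, hF⟩ := h.exists_holomorphic_raySolution θe
  have hb : ∀ τ : ℂ, |τ.im| < 1 → ∀ t ∈ Ioo (0 : ℝ) 1,
      ‖complexGaugeIntegrand c (F τ) t‖ ≤ 1 / 4 := fun τ hτ t ht =>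
    h.norm_complexGaugeIntegrand_le (hF τ hτ).2.norm_le ht.1
  have hi : ∀ τ : ℂ, |τ.im| < 1 →
      IntegrableOn (complexGaugeIntegrand c (F τ)) (Ioo 0 1) := fun τ hτ =>
    h.integrableOn_complexGaugeIntegrand (hF τ hτ).1 (hF τ hτ).2.norm_le
  -- The domination lemma asks for bounds at every `t`, while those on the integrand hold for `t >
  -- 0`; hence an indicator in place of a restricted measure.
  let G : ℂ → ℝ → ℂ := fun τ => (Ioo (0 : ℝ) 1).indicator (complexGaugeIntegrand c (F τ))
  have hopen : IsOpen {τ : ℂ | |τ.im| < 1} := isOpen_lt (by fun_prop) continuous_const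
  have hG : DifferentiableOn ℂ (fun τ => ∫ t, G τ t) {τ | |τ.im| < 1} := by
    refine differentiableOn_integral_of_dominated hopen
      (b := (Ioo (0 : ℝ) 1).indicator fun _ => 1 / 4) (fun τ hτ => ?_) (fun τ hτ t => ?_) ?_
      fun t => ?_
    · exact ((integrable_indicator_iff measurableSet_Ioo).2 (hi τ hτ)).aestronglyMeasurable
    · by_cases ht : t ∈ Ioo (0 : ℝ) 1
      · simpa only [G, indicator_of_mem ht] using hb τ hτ t ht
      · simp only [G, indicator_of_notMem ht, norm_zero, le_refl]
    · exact (integrable_indicator_iff measurableSet_Ioo).2 (integrableOn_const (by simp))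
    · by_cases ht : t ∈ Ioo (0 : ℝ) 1
      · simp only [G, indicator_of_mem ht, complexGaugeIntegrand]
        have h1 : ∀ γ ∈ bpsCharges c, DifferentiableOn ℂ
            (fun τ => (t : ℂ)⁻¹ * Complex.log (1 - F τ γ t)) {τ | |τ.im| < 1} := fun γ hγ =>
          (((hFd γ t).const_sub 1).clog fun τ hτ => one_sub_mem_slitPlane
            (h.norm_inv_mul_log_le (hF τ hτ).2.norm_le hγ ht.1).1).const_mul _
        exact DifferentiableOn.fun_sum fun γ hγ =>
          (h1 γ (mem_bpsCharges_of_mem_gaugeCharges hγ).1).sub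
            (h1 (-γ) (mem_bpsCharges_of_mem_gaugeCharges hγ).2)
      · simp only [G, indicator_of_notMem ht]
        exact differentiableOn_const 0
  have hGi : ∀ τ, ∫ t, G τ t = ∫ t in Ioo (0 : ℝ) 1, complexGaugeIntegrand c (F τ) t := fun τ =>
    integral_indicator measurableSet_Ioo
  refine ⟨fun τ => ((1 / (2 * Real.pi) : ℝ) : ℂ) * ∫ t, G τ t, hG.const_mul _, fun τ hτ => ?_,
    fun θm X hX => ?_⟩
  · have h1 : ‖∫ t, G τ t‖ ≤ 1 / 4 := by
      rw [hGi]
      simpa using norm_setIntegral_le_of_norm_le_const (μ := volume) (by simp) (hb τ hτ)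
    have h2 : 1 / (2 * Real.pi) ≤ 1 := by
      rw [div_le_one (by positivity)]
      linarith [Real.pi_gt_three]
    rw [norm_mul, Complex.norm_real, Real.norm_of_nonneg (by positivity)]
    calc _ ≤ 1 * (1 / 4 : ℝ) := mul_le_mul h2 h1 (norm_nonneg _) zero_le_one
      _ = 1 / 4 := one_mul _
  · have hθ : |(θm : ℂ).im| < 1 := by simp
    have heq : ∀ t ∈ Ioo (0 : ℝ) 1,
        gaugeIntegrand c Z X t = (complexGaugeIntegrand c (F θm) t).re := fun t ht =>
      h.re_complexGaugeIntegrand (hF θm hθ).2.norm_le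
        (fun γ hγ s hs => h.raySolution_unique hθ (h.isRaySolution hX) (hF θm hθ).2 hγ hs) ht.1
    refine ⟨IntegrableOn.congr_fun (Integrable.re (hi θm hθ)) (fun t ht => (heq t ht).symm) measurableSet_Ioo, ?_⟩
    have h1 : ∫ t in Ioo (0 : ℝ) 1, (complexGaugeIntegrand c (F θm) t).re =
        (∫ t in Ioo (0 : ℝ) 1, complexGaugeIntegrand c (F θm) t).re := integral_re (hi θm hθ)
    rw [psi, setIntegral_congr_fun measurableSet_Ioo heq, h1, Complex.re_ofReal_mul, hGi]

/-- The phases have period 2π in `τ`, so both solutions satisfy the same ray equation and agree on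
the rays. -/
theorem psi_periodic {θe θm : ℝ} {X X' : Charge → ℂ → ℂ} (hX : IsSolution c R Z θe θm X)
    (hX' : IsSolution c R Z θe (θm + 2 * Real.pi) X') : psi c Z X' = psi c Z X := by
  have hr := h.isRaySolution hX
  have hr' := h.isRaySolution hX'
  have hr'' : IsRaySolution c R Z θe θm fun γ s => X' γ (rayPoint (centralCharge Z γ) s) := by
    refine ⟨hr'.norm_le, hr'.integrable, fun γ hγ s hs => ?_⟩
    rw [← phase_add_two_pi]
    have := hr'.equation γ hγ s hs
    push_cast at this
    exact this
  have heq : ∀ t ∈ Ioo (0 : ℝ) 1, gaugeIntegrand c Z X' t = gaugeIntegrand c Z X t := by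
    intro t ht
    rw [h.re_complexGaugeIntegrand hr.norm_le (fun γ _ s _ => rfl) ht.1]
    exact h.re_complexGaugeIntegrand hr.norm_le
      (fun γ hγ s hs => h.raySolution_unique (by simp) hr'' hr hγ hs) ht.1
  rw [psi, psi, setIntegral_congr_fun measurableSet_Ioo heq]

end RayBounds

/-- Cauchy's estimate on a disc of radius 1/2, which lies inside the strip: (1/4)/(1/2) = 1/2. -/
theorem norm_deriv_le_half {H : ℂ → ℂ} (hH : DifferentiableOn ℂ H {τ | |τ.im| < 1})
    (hb : ∀ τ : ℂ, |τ.im| < 1 → ‖H τ‖ ≤ 1 / 4) (x : ℝ) : ‖deriv H x‖ ≤ 1 / 2 := by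
  have hsub : Metric.closedBall (x : ℂ) (1 / 2) ⊆ {τ | |τ.im| < 1} := by
    intro τ hτ
    rw [mem_closedBall_iff_norm] at hτ
    have := Complex.abs_im_le_norm (τ - x)
    rw [Complex.sub_im, Complex.ofReal_im, sub_zero] at this
    exact lt_of_le_of_lt (this.trans hτ) (by norm_num)
  refine (Complex.norm_deriv_le_of_forall_mem_sphere_norm_le (R := 1 / 2) (C := 1 / 4)
    (by norm_num) (hH.diffContOnCl_ball hsub)
    fun z hz => hb z (hsub (Metric.sphere_subset_closedBall hz))).trans (by norm_num)

end Gauge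

end Pentagon
-- The main theorem
theorem mainTheorem6 (c : Pentagon.Chamber) (K : Set (ℂ × ℂ)) (hK : IsCompact K)
    (hwall : ∀ Z ∈ K, (Z.1 * (starRingEnd ℂ) Z.2).im ≠ 0) :
    ∃ R₀ : ℝ, 0 < R₀ ∧ ∀ R : ℝ, R₀ ≤ R → ∀ Z ∈ K, ∀ θe : ℝ,
      (∀ θm : ℝ, ∃ X : Pentagon.Charge → ℂ → ℂ, Pentagon.IsSolution c R Z θe θm X) ∧
      ∀ X : ℝ → Pentagon.Charge → ℂ → ℂ,
        (∀ θm : ℝ, Pentagon.IsSolution c R Z θe θm (X θm)) →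
        (∀ θm : ℝ, IntegrableOn (Pentagon.gaugeIntegrand c Z (X θm)) (Ioo 0 1)) ∧
        Pentagon.InducesCircleDiffeo (fun θm : ℝ => θm + Pentagon.psi c Z (X θm)) := by
  obtain ⟨R₀, C, δ, hR₀, hbounds⟩ := Pentagon.exists_rayBounds c hK hwall
  refine ⟨R₀, hR₀, fun R hR Z hZ θe => ?_⟩
  have h := hbounds R hR Z hZ
  refine ⟨fun θm => ?_, fun X hX => ?_⟩
  · obtain ⟨F, -, hF⟩ := h.exists_holomorphic_raySolution θe
    exact h.exists_isSolution (hF θm (by simp)).2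
  obtain ⟨H, hH, hHb, hHpsi⟩ := h.exists_holomorphic_psi θe
  refine ⟨fun θm => (hHpsi θm (X θm) (hX θm)).1, ?_⟩
  have hQ : (fun θm : ℝ => θm + Pentagon.psi c Z (X θm)) = fun θm : ℝ => θm + (H θm).re :=
    funext fun θm => by rw [(hHpsi θm (X θm) (hX θm)).2]
  have hopen : IsOpen {τ : ℂ | |τ.im| < 1} := isOpen_lt (by fun_prop) continuous_const
  have hnhds : ∀ x : ℝ, {τ : ℂ | |τ.im| < 1} ∈ nhds (x : ℂ) := fun x =>
    hopen.mem_nhds (by simp)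
  refine Pentagon.inducesCircleDiffeo_of_deriv_pos ?_ (fun θm => ?_) fun θm => ?_
  · rw [hQ]
    refine contDiff_id.add (contDiff_iff_contDiffAt.2 fun x => ?_)
    exact (hH.analyticAt (hnhds x)).contDiffAt.real_of_complex
  · rw [h.psi_periodic (hX θm) (hX (θm + 2 * Real.pi))]
    ring
  -- On the real axis Q' = 1 + Re H' ≥ 1 - 1/2.
  · have h1 := (hH.differentiableAt (hnhds θm)).hasDerivAt.real_of_complex
    rw [hQ, ((hasDerivAt_id' θm).fun_add h1).deriv]
    have h2 := (Complex.abs_re_le_norm _).trans (Pentagon.norm_deriv_le_half hH hHb θm)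
    linarith [neg_abs_le (deriv H θm).re]
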